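/- Let $X$ be a finite-dimensional real normed space with dual $X^*$. For a lower semicontinuous $g:X\to\mathbb{R}\cup\{+\infty\}$ and $x\in X$ with $g(x)\in\mathbb{R}$ put $$\hat\partial g(x)=\Big\{x^*\in X^*:\ \liminf_{h\to0}\frac{g(x+h)-g(x)-\langle x^*,h\rangle}{\|h\|}\ge 0\Big\},$$ $$\partial g(x)=\{\lim x_n^*:\ x_n^*\in\hat\partial g(x_n),\ x_n\to x,\ g(x_n)\to g(x)\},$$ $$\partial^\infty g(x)=\{\lim \lambda_nx_n^*:\ x_n^*\in\hat\partial g(x_n),\ x_n\to x,\ g(x_n)\to g(x),\ \lambda_n\to0^+\},$$ and let all three sets be empty if $g(x)$ is infinite (the same definitions are used for $g:X\to[-\infty,+\infty]$). Let $T$ be a subset of a metric space whose closure $\overline T$ is compact, let $f_t:X\to\mathbb{R}\cup\{+\infty\}$ ($t\in T$) be lower semicontinuous, let $f(x)=\sup_{t\in T}f_t(x)$, and let $\bar x\in X$. For $t\in\overline T\setminus T$ define the extended subdifferentials at $\bar x$: $\partial f_t(\bar x)$ is the set of all limits $x^*=\lim x_k^*$ with $x_k^*\in\hat\partial f_{t_k}(x_k)$,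 $t_k\in T$, $t_k\to t$, $x_k\to\bar x$ and $f_{t_k}(x_k)\to f(\bar x)$; $\partial^\infty f_t(\bar x)$ is the set of all limits $x^*=\lim \eta_kx_k^*$ with $x_k^*\in\hat\partial f_{t_k}(x_k)$, $t_k\in T$, $t_k\to t$, $\eta_k\to0^+$, $x_k\to\bar x$ and $\limsup f_{t_k}(x_k)\le f(\bar x)$. Let $\overline T(\bar x)=\{t\in T: f_t(\bar x)\ge f(\bar x)\}\cup(\overline T\setminus T)$. Assume: (a) for every $\bar t\in T$, $\limsup_{(t,x)\to(\bar t,\bar x)}f_t(x)\le f_{\bar t}(\bar x)$, where $(t,x)$ ranges over $T\times X$; (b) the family is continuously subdifferentiable at $\bar x$: whenever $t_n,t\in T$, $x_n\in X$, $\lambda_n,\lambda\in[0,\infty)$ satisfy $(t_n,x_n,\lambda_n)\to(t,\bar x,\lambda)$, and $w_n^*\in\hat\partial f_{t_n}(x_n)$ satisfy $\lambda_nw_n^*\to w^*$, then $w^*\in\lambda\,\partial f_t(\bar x)$ if $\lambda>0$, and $w^*\in\partial^\infty f_t(\bar x)$ if $\lambda=0$; (c) the convex hull $\operatorname{co}\big(\bigcup_{t\in\overline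 T}\partial^\infty f_t(\bar x)\big)$ contains no line. Then $$\partial f(\bar x)\subseteq \operatorname{co}\Big(\bigcup_{t\in\overline T(\bar x)}\partial f_t(\bar x)\Big)+\operatorname{co}\Big(\bigcup_{t\in\overline T}\partial^\infty f_t(\bar x)\Big)\quad\text{and}\quad \partial^\infty f(\bar x)\subseteq \operatorname{co}\Big(\bigcup_{t\in\overline T}\partial^\infty f_t(\bar x)\Big).$$ -/

import Mathlib

open Set Filter Topology
open scoped Pointwise

noncomputable section

namespace SupSubdiff

/-- The Fréchet (regular) subdifferential of `f` at `x`; empty where `f x` is infinite. -/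
def frechetSub {X : Type*} [NormedAddCommGroup X] [NormedSpace ℝ X]
    (f : X → EReal) (x : X) : Set (StrongDual ℝ X) :=
  {xs | f x ≠ ⊥ ∧ f x ≠ ⊤ ∧
    0 ≤ liminf (fun h : X => (f (x + h) - f x - ((xs h : ℝ) : EReal)) / ((‖h‖ : ℝ) : EReal))
      (𝓝[≠] (0 : X))}

/-- The limiting (Mordukhovich) subdifferential of `f` at `x`; empty where `f x` is infinite.
The dual carries its norm topology, which is the weak* topology when `X` is finite-dimensional. -/
def limitingSub {X : Type*} [NormedAddCommGroup X] [NormedSpace ℝ X]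
    (f : X → EReal) (x : X) : Set (StrongDual ℝ X) :=
  {xs | f x ≠ ⊥ ∧ f x ≠ ⊤ ∧
    ∃ (u : ℕ → X) (us : ℕ → StrongDual ℝ X),
      (∀ n, us n ∈ frechetSub f (u n)) ∧
      Tendsto u atTop (𝓝 x) ∧ Tendsto (fun n => f (u n)) atTop (𝓝 (f x)) ∧
      Tendsto us atTop (𝓝 xs)}

/-- The singular (limiting) subdifferential of `f` at `x`; empty where `f x` is infinite. -/
def singularSub {X : Type*} [NormedAddCommGroup X] [NormedSpace ℝ X]
    (f : X → EReal) (x : X) : Set (StrongDual ℝ X) :=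
  {xs | f x ≠ ⊥ ∧ f x ≠ ⊤ ∧
    ∃ (u : ℕ → X) (us : ℕ → StrongDual ℝ X) (η : ℕ → ℝ),
      (∀ n, us n ∈ frechetSub f (u n)) ∧
      Tendsto u atTop (𝓝 x) ∧ Tendsto (fun n => f (u n)) atTop (𝓝 (f x)) ∧
      Tendsto η atTop (𝓝[>] 0) ∧ Tendsto (fun n => η n • us n) atTop (𝓝 xs)}

/-- The supremum function of the family. -/
def supFun {ι X : Type*} (f : ι → X → EReal) (x : X) : EReal := ⨆ t, f t x

/-- `λ ∘ ∂g(x)`: equal to `λ ∂g(x)` for `λ > 0` and to the singular subdifferential for `λ = 0`. -/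
def scaledSub {X : Type*} [NormedAddCommGroup X] [NormedSpace ℝ X]
    (l : ℝ) (g : X → EReal) (x : X) : Set (StrongDual ℝ X) :=
  {ws | (0 < l ∧ ws ∈ l • limitingSub g x) ∨ (l = 0 ∧ ws ∈ singularSub g x)}

/-- Continuous subdifferentiability at `x` of a family indexed by a subset `T` of a metric
space, with respect to the Fréchet subdifferential. -/
def ContinuouslySubdifferentiable {M X : Type*} [MetricSpace M]
    [NormedAddCommGroup X] [NormedSpace ℝ X]
    {T : Set M} (f : T → X → EReal) (x : X) : Prop :=
  ∀ (t : ℕ → T) (u : ℕ → X) (l : ℕ → ℝ) (us : ℕ → StrongDual ℝ X)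
    (t₀ : T) (l₀ : ℝ) (ws : StrongDual ℝ X),
    (∀ n, 0 ≤ l n) → Tendsto t atTop (𝓝 t₀) → Tendsto u atTop (𝓝 x) →
    Tendsto l atTop (𝓝 l₀) → (∀ n, us n ∈ frechetSub (f (t n)) (u n)) →
    Tendsto (fun n => l n • us n) atTop (𝓝 ws) →
    ws ∈ scaledSub l₀ (f t₀) x

open Classical in
/-- `∂f_t(x)` for `t ∈ M`: the limiting subdifferential of `f_t` when `t ∈ T`, and the extended
subdifferential at `(t, x)` when `t ∉ T` (used for `t ∈ closure T \ T`). -/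
def extLimitingSub {M X : Type*} [MetricSpace M] [NormedAddCommGroup X] [NormedSpace ℝ X]
    {T : Set M} (f : T → X → EReal) (t : M) (x : X) : Set (StrongDual ℝ X) :=
  if h : t ∈ T then limitingSub (f ⟨t, h⟩) x else
    {xs | ∃ (s : ℕ → T) (u : ℕ → X) (us : ℕ → StrongDual ℝ X),
      Tendsto (fun k => (s k : M)) atTop (𝓝 t) ∧ Tendsto u atTop (𝓝 x) ∧
      (∀ k, us k ∈ frechetSub (f (s k)) (u k)) ∧
      Tendsto (fun k => f (s k) (u k)) atTop (𝓝 (supFun f x)) ∧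
      Tendsto us atTop (𝓝 xs)}

open Classical in
/-- `∂^∞ f_t(x)` for `t ∈ M`: the singular subdifferential of `f_t` when `t ∈ T`, and the extended
singular subdifferential at `(t, x)` when `t ∉ T` (used for `t ∈ closure T \ T`). -/
def extSingularSub {M X : Type*} [MetricSpace M] [NormedAddCommGroup X] [NormedSpace ℝ X]
    {T : Set M} (f : T → X → EReal) (t : M) (x : X) : Set (StrongDual ℝ X) :=
  if h : t ∈ T then singularSub (f ⟨t, h⟩) x else
    {xs | ∃ (s : ℕ → T) (η : ℕ → ℝ) (u : ℕ → X) (us : ℕ → StrongDual ℝ X),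
      Tendsto (fun k => (s k : M)) atTop (𝓝 t) ∧ Tendsto η atTop (𝓝[>] 0) ∧
      Tendsto u atTop (𝓝 x) ∧ (∀ k, us k ∈ frechetSub (f (s k)) (u k)) ∧
      limsup (fun k => f (s k) (u k)) atTop ≤ supFun f x ∧
      Tendsto (fun k => η k • us k) atTop (𝓝 xs)}

/-- The extended active index set: the indices `t ∈ T` with `f_t(x) ≥ sup_s f_s(x)`, together
with all of `closure T \ T`. -/
def extActive {M X : Type*} [MetricSpace M] {T : Set M} (f : T → X → EReal) (x : X) : Set M :=
  {t | ∃ h : t ∈ T, supFun f x ≤ f ⟨t, h⟩ x} ∪ (closure T \ T)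

/-- `K` contains a line, not necessarily through the origin. -/
def ContainsLine {V : Type*} [AddCommGroup V] [Module ℝ V] (K : Set V) : Prop :=
  ∃ a d : V, d ≠ 0 ∧ ∀ s : ℝ, a + s • d ∈ K

end SupSubdiff

end

/-!
The subdifferentials of a supremum are computed from an approximate rule for Fréchet subgradients,
followed by a compactness argument.

*Approximate rule* (`exists_mem_convexHull_of_mem_frechetSub_supFun`). A Fréchet subgradient `x*` of
`f = sup f_t` at `x` makes `x` an approximate minimiser of `f - x*` up to a small multiple of
`‖· - x‖`. Lower semicontinuity and compactness of balls allow the supremum to be replaced by the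
maximum over a finite subfamily (`exists_finset_uniform_lt`). For a finite family no qualification
condition is needed if one gives each function its own variable `x_j`, ties these variables to a
common point by a strong quadratic penalty, and replaces the maximum by the smooth maximum
`N⁻¹ log ∑ exp (N ·)` (`exists_multipliers_of_fintype`). At a minimiser, the smooth maximum being
strictly increasing, each `x_j` satisfies a first-order condition that exhibits a Fréchet
subgradient of `f_j` at `x_j`; the positive softmax weights are the multipliers, and optimality in
the common point says that the weighted sum of these subgradients is close to `x*`. The entropy
bound for the smooth maximum shows that the weighted mean of the values `f_j (x_j)` is close to
`f x`, while none of them exceeds `f x` by much. Carathéodory's theorem, applied to the pairs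
(subgradient, value), then bounds the number of terms by the dimension and keeps both properties.

*Passage to the limit.* Along a sequence defining a limiting or singular subgradient of `f`, the
indices and weights converge along a subsequence. The weighted subgradients stay bounded along a
subsequence: otherwise, after normalisation, they converge to singular subgradients that sum to
zero and do not all vanish, so that the convex hull of the singular subgradients contains a line
(`not_tendsto_norm_atTop`). In the limit, terms whose weight vanishes become singular subgradients
(`mem_extSingularSub_of_tendsto`). Terms whose weight has a positive limit must have values tending
to `f x`, because the weighted mean does (`tendsto_of_sum_mul_tendsto`), so their limit index is
active and they give limiting subgradients. For singular subgradients of `f` all weights vanish.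
-/

namespace SupSubdiff

/-! ### The Fréchet subdifferential as a first-order lower bound -/

/-- Membership in the Fréchet subdifferential without division in the extended reals. -/
theorem mem_frechetSub_iff {X : Type*} [NormedAddCommGroup X] [NormedSpace ℝ X]
    {f : X → EReal} {x : X} {xs : StrongDual ℝ X} :
    xs ∈ frechetSub f x ↔ ∃ r : ℝ, f x = r ∧ ∀ ε > 0, ∀ᶠ h in 𝓝 (0 : X),
      ((r + xs h - ε * ‖h‖ : ℝ) : EReal) ≤ f (x + h) := by
  constructor
  · rintro ⟨hb, ht, hl⟩
    lift f x to ℝ using ⟨ht, hb⟩ with r hr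
    refine ⟨r, rfl, fun ε hε => ?_⟩
    have h1 : ((-ε : ℝ) : EReal) < liminf (fun h : X =>
        (f (x + h) - r - ((xs h : ℝ) : EReal)) / ((‖h‖ : ℝ) : EReal)) (𝓝[≠] (0 : X)) :=
      lt_of_lt_of_le (by exact_mod_cast neg_lt_zero.2 hε) hl
    have h2 := eventually_nhdsWithin_iff.1 (eventually_lt_of_lt_liminf h1)
    filter_upwards [h2] with h hh
    rcases eq_or_ne h 0 with rfl | h0
    · simp [hr]
    · have hh := hh h0
      have hpos : 0 < ‖h‖ := norm_pos_iff.2 h0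
      induction hfx : f (x + h) with
      | top => exact le_top
      | bot =>
        rw [hfx] at hh
        simp [EReal.bot_sub, EReal.bot_div_of_pos_ne_top (show (0 : EReal) < ((‖h‖ : ℝ) : EReal) by
          exact_mod_cast hpos) (EReal.coe_ne_top _)] at hh
      | coe c =>
        rw [hfx] at hh
        have hh' : -ε < (c - r - xs h) / ‖h‖ := by
          rw [← EReal.coe_sub, ← EReal.coe_sub, ← EReal.coe_div] at hh
          exact_mod_cast hh
        rw [lt_div_iff₀ hpos] at hh'
        exact_mod_cast (by linarith : r + xs h - ε * ‖h‖ ≤ c)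
  · rintro ⟨r, hr, H⟩
    refine ⟨by simp [hr], by simp [hr], ?_⟩
    rw [hr]
    refine le_of_forall_lt fun a ha => ?_
    obtain ⟨e, he1, he2⟩ := EReal.lt_iff_exists_real_btwn.1 ha
    have he0 : e < 0 := by exact_mod_cast he2
    refine lt_of_lt_of_le he1 ?_
    refine le_liminf_of_le (by isBoundedDefault) (eventually_nhdsWithin_iff.2 ?_)
    filter_upwards [H (-e) (by linarith)] with h hh h0
    have hpos : 0 < ‖h‖ := norm_pos_iff.2 h0
    induction hfx : f (x + h) with
    | top =>
      have : ((⊤ : EReal) - (r : EReal) - ((xs h : ℝ) : EReal)) = ⊤ := by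
        rw [EReal.top_sub_coe, EReal.top_sub_coe]
      rw [this, EReal.top_div_of_pos_ne_top (by exact_mod_cast hpos) (EReal.coe_ne_top _)]
      exact le_top
    | bot => rw [hfx] at hh; exact absurd (le_bot_iff.1 hh) (EReal.coe_ne_bot _)
    | coe c =>
      rw [hfx] at hh
      have hh' : r + xs h - (-e) * ‖h‖ ≤ c := by exact_mod_cast hh
      have : e ≤ (c - r - xs h) / ‖h‖ := by
        rw [le_div_iff₀ hpos]; linarith
      rw [← EReal.coe_sub, ← EReal.coe_sub, ← EReal.coe_div]
      exact_mod_cast this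

/-! ### The log-sum-exp function and its weights -/

/-- The smooth maximum `N⁻¹ log ∑ⱼ exp (N vⱼ)`. -/
noncomputable def logSumExp {J : Type*} [Fintype J] (N : ℝ) (v : J → ℝ) : ℝ :=
  Real.log (∑ j, Real.exp (N * v j)) / N

/-- The partial derivatives of `logSumExp N` at `v`; they are positive and sum to one. -/
noncomputable def softmaxWeight {J : Type*} [Fintype J] (N : ℝ) (v : J → ℝ) (j : J) : ℝ :=
  Real.exp (N * v j) / ∑ i, Real.exp (N * v i)

section LogSumExp

variable {J : Type*} [Fintype J] [Nonempty J] {N : ℝ}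

theorem sum_exp_pos (v : J → ℝ) : 0 < ∑ j, Real.exp (N * v j) :=
  Finset.sum_pos (fun _ _ => Real.exp_pos _) Finset.univ_nonempty

theorem softmaxWeight_pos (v : J → ℝ) (j : J) : 0 < softmaxWeight N v j :=
  div_pos (Real.exp_pos _) (sum_exp_pos v)

theorem sum_softmaxWeight (v : J → ℝ) : ∑ j, softmaxWeight N v j = 1 := by
  simp only [softmaxWeight]
  rw [← Finset.sum_div, div_self (sum_exp_pos v).ne']

theorem le_logSumExp (hN : 0 < N) (v : J → ℝ) (j : J) : v j ≤ logSumExp N v := by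
  rw [logSumExp, le_div_iff₀ hN, Real.le_log_iff_exp_le (sum_exp_pos v), mul_comm]
  exact Finset.single_le_sum (f := fun i => Real.exp (N * v i))
    (fun _ _ => (Real.exp_pos _).le) (Finset.mem_univ j)

theorem logSumExp_le (hN : 0 < N) {v : J → ℝ} {m : ℝ} (hv : ∀ j, v j ≤ m) :
    logSumExp N v ≤ m + Fintype.card J / N := by
  have hc : (0 : ℝ) < Fintype.card J := by exact_mod_cast Fintype.card_pos
  have h1 : ∑ j, Real.exp (N * v j) ≤ Fintype.card J * Real.exp (N * m) := by
    have := Finset.sum_le_card_nsmul Finset.univ (fun j => Real.exp (N * v j)) (Real.exp (N * m))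
      (fun j _ => Real.exp_le_exp.2 (mul_le_mul_of_nonneg_left (hv j) hN.le))
    simpa [nsmul_eq_mul] using this
  have h2 : Real.log (∑ j, Real.exp (N * v j)) ≤ Fintype.card J + N * m := by
    refine (Real.log_le_log (sum_exp_pos v) h1).trans ?_
    rw [Real.log_mul hc.ne' (Real.exp_ne_zero _), Real.log_exp]
    have := Real.log_le_sub_one_of_pos hc
    linarith
  rw [logSumExp, div_le_iff₀ hN, add_mul, div_mul_cancel₀ _ hN.ne']
  linarith

/-- The weights nearly attain the smooth maximum: the defect is the entropy divided by `N`. -/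
theorem logSumExp_sub_le_sum_softmaxWeight_mul (hN : 0 < N) (v : J → ℝ) :
    logSumExp N v - Fintype.card J / N ≤ ∑ j, softmaxWeight N v j * v j := by
  have h1 : ∀ j, softmaxWeight N v j * logSumExp N v - 1 / N ≤ softmaxWeight N v j * v j := by
    intro j
    have hw := softmaxWeight_pos (N := N) v j
    have hlog : Real.log (softmaxWeight N v j) = N * v j - N * logSumExp N v := by
      rw [softmaxWeight, Real.log_div (Real.exp_ne_zero _) (sum_exp_pos v).ne', Real.log_exp,
        logSumExp]
      field_simp
    have h2 := Real.one_sub_inv_le_log_of_pos hw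
    have h3 : -1 ≤ softmaxWeight N v j * Real.log (softmaxWeight N v j) := by
      have := mul_le_mul_of_nonneg_left h2 hw.le
      rw [mul_sub, mul_inv_cancel₀ hw.ne'] at this
      linarith
    rw [hlog] at h3
    have h4 : -1 / N ≤ softmaxWeight N v j * (v j - logSumExp N v) := by
      rw [div_le_iff₀ hN]; linarith
    have h5 : -1 / N = -(1 / N) := by ring
    rw [h5] at h4
    linarith
  have h2 := Finset.sum_le_sum (fun j (_ : j ∈ Finset.univ) => h1 j)
  rw [Finset.sum_sub_distrib, ← Finset.sum_mul, sum_softmaxWeight] at h2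
  simpa [div_eq_mul_inv] using h2

/-- The logarithm being concave, changing one entry raises `logSumExp` at most by its linearisation
in the exponential of that entry. -/
theorem logSumExp_update_le [DecidableEq J] (hN : 0 < N) (v : J → ℝ) (j : J) (a : ℝ) :
    logSumExp N (Function.update v j a) ≤
      logSumExp N v + softmaxWeight N v j * (Real.exp (N * (a - v j)) - 1) / N := by
  have hS := sum_exp_pos (N := N) v
  have hS' := sum_exp_pos (N := N) (Function.update v j a)
  have hsum : ∑ i, Real.exp (N * Function.update v j a i) =
      (∑ i, Real.exp (N * v i)) + (Real.exp (N * a) - Real.exp (N * v j)) := by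
    rw [← Finset.add_sum_erase _ _ (Finset.mem_univ j),
      ← Finset.add_sum_erase _ (fun i => Real.exp (N * v i)) (Finset.mem_univ j)]
    have : ∑ i ∈ Finset.univ.erase j, Real.exp (N * Function.update v j a i) =
        ∑ i ∈ Finset.univ.erase j, Real.exp (N * v i) :=
      Finset.sum_congr rfl fun i hi => by rw [Function.update_of_ne (Finset.ne_of_mem_erase hi)]
    rw [this, Function.update_self]
    ring
  have hratio : (∑ i, Real.exp (N * Function.update v j a i)) / (∑ i, Real.exp (N * v i)) - 1 =
      softmaxWeight N v j * (Real.exp (N * (a - v j)) - 1) := by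
    rw [hsum, softmaxWeight, mul_sub N, Real.exp_sub]
    have := Real.exp_ne_zero (N * v j)
    field_simp
    ring
  have h1 := Real.log_le_sub_one_of_pos (div_pos hS' hS)
  rw [hratio, Real.log_div hS'.ne' hS.ne'] at h1
  rw [logSumExp, logSumExp, ← add_div]
  gcongr
  linarith

theorem lowerSemicontinuous_logSumExp {E : Type*} [TopologicalSpace E] (hN : 0 < N)
    {g : J → E → ℝ} (hg : ∀ j, LowerSemicontinuous (g j)) :
    LowerSemicontinuous fun p => logSumExp N fun j => g j p := by
  have hsum : LowerSemicontinuous fun p => ∑ j, Real.exp (N * g j p) := by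
    refine lowerSemicontinuous_sum fun j _ => ?_
    have hc : Continuous fun s : ℝ => Real.exp (N * s) := by fun_prop
    exact hc.comp_lowerSemicontinuous (hg j)
      fun a b hab => Real.exp_le_exp.2 (mul_le_mul_of_nonneg_left hab hN.le)
  intro p c hc
  have key : ∀ p, c < logSumExp N (fun j => g j p) ↔ Real.exp (c * N) < ∑ j, Real.exp (N * g j p) :=
    fun p => by rw [logSumExp, lt_div_iff₀ hN, Real.lt_log_iff_exp_lt (sum_exp_pos _)]
  filter_upwards [hsum p _ ((key p).1 hc)] with p' hp' using (key p').2 hp'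

end LogSumExp

/-! ### First-order conditions under a quadratic penalty -/

/-- A finite-dimensional space carries a positive definite symmetric bilinear form, which serves as
a smooth substitute for the square of its norm. -/
theorem exists_posDef_bilin (X : Type*) [NormedAddCommGroup X] [NormedSpace ℝ X]
    [FiniteDimensional ℝ X] :
    ∃ (b : X →L[ℝ] StrongDual ℝ X) (c : ℝ), 0 < c ∧ (∀ u v, b u v = b v u) ∧
      ∀ u, c * ‖u‖ ^ 2 ≤ b u u := by
  let L : X ≃L[ℝ] EuclideanSpace ℝ (Fin (Module.finrank ℝ X)) := toEuclidean
  obtain ⟨a, ha, hL⟩ : ∃ a > 0, ∀ u, ‖u‖ ≤ a * ‖L u‖ := by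
    refine ⟨‖(L.symm : EuclideanSpace ℝ (Fin (Module.finrank ℝ X)) →L[ℝ] X)‖ + 1,
      by positivity, fun u => ?_⟩
    have := (L.symm : EuclideanSpace ℝ (Fin (Module.finrank ℝ X)) →L[ℝ] X).le_opNorm (L u)
    simp only [ContinuousLinearEquiv.coe_coe, ContinuousLinearEquiv.symm_apply_apply] at this
    nlinarith [norm_nonneg (L u)]
  let L' : X →L[ℝ] EuclideanSpace ℝ (Fin (Module.finrank ℝ X)) := L
  refine ⟨(innerSL ℝ).bilinearComp L' L', (a ^ 2)⁻¹, by positivity,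
    fun u v => ?_, fun u => ?_⟩
  · simp only [ContinuousLinearMap.bilinearComp_apply, innerSL_apply_apply]
    exact real_inner_comm _ _
  · have h1 : ‖u‖ ^ 2 ≤ a ^ 2 * ‖L u‖ ^ 2 := by
      rw [← mul_pow]; exact pow_le_pow_left₀ (norm_nonneg _) (hL u) 2
    rw [inv_mul_le_iff₀ (by positivity)]
    simpa [L'] using h1

variable {X : Type*} [NormedAddCommGroup X] [NormedSpace ℝ X]

/-- A linear form that stays above `-a ‖·‖` up to a quadratic error near the origin has norm at
most `a`, by homogeneity. -/
theorem opNorm_le_of_eventually_nonneg {l : StrongDual ℝ X} {a C : ℝ} (ha : 0 ≤ a)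
    (h : ∀ᶠ v in 𝓝 (0 : X), 0 ≤ l v + a * ‖v‖ + C * ‖v‖ ^ 2) : ‖l‖ ≤ a := by
  have key : ∀ v, -(l v) ≤ a * ‖v‖ := by
    intro v
    have ht : Tendsto (fun s : ℝ => s • v) (𝓝[>] 0) (𝓝 0) := by
      have : Continuous fun s : ℝ => s • v := by fun_prop
      simpa using (this.tendsto 0).mono_left nhdsWithin_le_nhds
    have h1 : ∀ᶠ s : ℝ in 𝓝[>] 0, 0 ≤ l v + a * ‖v‖ + s * (C * ‖v‖ ^ 2) := by
      filter_upwards [ht.eventually h, self_mem_nhdsWithin] with s hs hs0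
      have hs0 : 0 < s := hs0
      rw [norm_smul, Real.norm_of_nonneg hs0.le, map_smul, smul_eq_mul] at hs
      have : 0 ≤ s * (l v + a * ‖v‖ + s * (C * ‖v‖ ^ 2)) := by linarith
      exact nonneg_of_mul_nonneg_right this hs0
    have h2 : Tendsto (fun s : ℝ => l v + a * ‖v‖ + s * (C * ‖v‖ ^ 2)) (𝓝[>] 0)
        (𝓝 (l v + a * ‖v‖ + 0 * (C * ‖v‖ ^ 2))) := by
      have : Continuous fun s : ℝ => l v + a * ‖v‖ + s * (C * ‖v‖ ^ 2) := by fun_prop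
      exact (this.tendsto 0).mono_left nhdsWithin_le_nhds
    have := ge_of_tendsto h2 h1
    linarith
  refine l.opNorm_le_bound ha fun v => ?_
  rw [Real.norm_eq_abs, abs_le]
  have h1 := key v
  have h2 := key (-v)
  rw [map_neg, norm_neg] at h2
  constructor <;> linarith

/-- Taking a logarithm in the optimality condition of one decoupled variable turns the quadratic
penalty into a first-order minorant of `g`, with a quadratic error. -/
theorem eventually_quadratic_minorant {g : X → ℝ} {x u : X} {N k w : ℝ} (hN : 0 < N) (hw : 0 < w)
    (b : X →L[ℝ] StrongDual ℝ X)
    (h : ∀ᶠ v in 𝓝 (0 : X), 0 ≤ w * (Real.exp (N * (g (x + v) - g x)) - 1) / N +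
      k * (2 * b u v + b v v)) :
    ∃ C : ℝ, ∀ᶠ v in 𝓝 (0 : X),
      g x + (-(2 * k / w) • b u) v - C * ‖v‖ ^ 2 ≤ g (x + v) := by
  set A : ℝ := N * |k| / w with hA
  have hA0 : 0 ≤ A := by positivity
  refine ⟨(A * ‖b‖ + 2 * (A * (2 * ‖b u‖ + ‖b‖)) ^ 2) / N, ?_⟩
  -- `z v` is the relative decrease of the exponential that the penalty allows
  set z : X → ℝ := fun v => N * k / w * (2 * b u v + b v v) with hz
  have hzc : Continuous z := by
    have : Continuous fun v => b v v := by
      exact b.continuous.clm_apply continuous_id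
    fun_prop
  have hz0 : z 0 = 0 := by simp [hz]
  have hz1 : ∀ᶠ v in 𝓝 (0 : X), z v < 1 / 2 :=
    hzc.continuousAt.eventually_lt continuousAt_const (by rw [hz0]; norm_num)
  have hball : ∀ᶠ v in 𝓝 (0 : X), ‖v‖ < 1 := by
    filter_upwards [Metric.ball_mem_nhds (0 : X) one_pos] with v hv using mem_ball_zero_iff.1 hv
  filter_upwards [h, hz1, hball] with v hv hzv hv1
  have hbvv : |b v v| ≤ ‖b‖ * ‖v‖ ^ 2 := by
    have := b.le_opNorm₂ v v
    rw [Real.norm_eq_abs] at this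
    linarith [this, sq ‖v‖]
  have hbuv : |b u v| ≤ ‖b u‖ * ‖v‖ := (b u).le_opNorm v
  have hv0 := norm_nonneg v
  have habsA : |N * k / w| = A := by
    rw [abs_div, abs_mul, abs_of_pos hN, abs_of_pos hw]
  have hzabs : |z v| ≤ A * (2 * ‖b u‖ + ‖b‖) * ‖v‖ := by
    rw [hz]
    simp only
    rw [abs_mul, habsA, mul_assoc]
    gcongr
    refine (abs_add_le _ _).trans ?_
    rw [abs_mul, abs_two]
    nlinarith [mul_nonneg (norm_nonneg b) hv0]
  have hexp : 1 - z v ≤ Real.exp (N * (g (x + v) - g x)) := by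
    have h1 : 0 ≤ (w / N) * (Real.exp (N * (g (x + v) - g x)) - 1 + z v) := by
      have : (w / N) * (Real.exp (N * (g (x + v) - g x)) - 1 + z v) =
          w * (Real.exp (N * (g (x + v) - g x)) - 1) / N + k * (2 * b u v + b v v) := by
        simp only [hz]; field_simp
      rw [this]; exact hv
    have := nonneg_of_mul_nonneg_right h1 (div_pos hw hN)
    linarith
  have hpos : 0 < 1 - z v := by linarith
  have hlog : -z v - 2 * z v ^ 2 ≤ N * (g (x + v) - g x) := by
    have h2 : Real.log (1 - z v) ≤ N * (g (x + v) - g x) := by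
      rw [Real.log_le_iff_le_exp hpos]; exact hexp
    -- the bound `-z - 2 z² ≤ log (1 - z)` needs `z ≤ 1 / 2`
    refine le_trans (le_trans ?_ (Real.one_sub_inv_le_log_of_pos hpos)) h2
    rw [← sub_nonneg]
    have : 1 - (1 - z v)⁻¹ - (-z v - 2 * z v ^ 2) = z v ^ 2 * (1 - 2 * z v) / (1 - z v) := by
      field_simp; ring
    rw [this]
    have : 0 ≤ 1 - 2 * z v := by linarith
    positivity
  have hsq : z v ^ 2 ≤ (A * (2 * ‖b u‖ + ‖b‖)) ^ 2 * ‖v‖ ^ 2 := by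
    rw [← mul_pow, ← sq_abs]
    exact pow_le_pow_left₀ (abs_nonneg _) hzabs 2
  have hlin : z v ≤ N * ((2 * k / w) * b u v) + A * (‖b‖ * ‖v‖ ^ 2) := by
    have h1 : z v = N * ((2 * k / w) * b u v) + N * k / w * b v v := by
      simp only [hz]; field_simp
    have h2 : N * k / w * b v v ≤ A * (‖b‖ * ‖v‖ ^ 2) := by
      refine (le_abs_self _).trans ?_
      rw [abs_mul, habsA]
      gcongr
    linarith
  have hfin : N * (g x + (-(2 * k / w) • b u) v -
      (A * ‖b‖ + 2 * (A * (2 * ‖b u‖ + ‖b‖)) ^ 2) / N * ‖v‖ ^ 2) ≤ N * g (x + v) := by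
    have : N * (g x + (-(2 * k / w) • b u) v -
      (A * ‖b‖ + 2 * (A * (2 * ‖b u‖ + ‖b‖)) ^ 2) / N * ‖v‖ ^ 2) =
      N * g x - N * ((2 * k / w) * b u v) - A * (‖b‖ * ‖v‖ ^ 2) -
        2 * ((A * (2 * ‖b u‖ + ‖b‖)) ^ 2 * ‖v‖ ^ 2) := by
      simp only [smul_apply, smul_eq_mul]
      field_simp
      ring
    rw [this]
    linarith
  exact le_of_mul_le_mul_left hfin hN

/-! ### Reduction to a finite subfamily -/

/-- On a compact set, a pointwise strict lower bound by a member of a lower semicontinuous family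
is realised by finitely many members, uniformly on small balls. -/
theorem exists_finset_uniform_lt {ι E : Type*} [PseudoMetricSpace E] {g : ι → E → ℝ}
    (hg : ∀ t, LowerSemicontinuous (g t)) {φ : E → ℝ} (hφ : Continuous φ) {K : Set E}
    (hK : IsCompact K) (h : ∀ y ∈ K, ∃ t, φ y < g t y) :
    ∃ (F : Finset ι) (ρ : ℝ), 0 < ρ ∧ ∀ y ∈ K, ∃ t ∈ F, ∀ x, dist x y < ρ → φ y < g t x := by
  classical
  refine hK.induction_on (p := fun S => ∃ (F : Finset ι) (ρ : ℝ), 0 < ρ ∧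
    ∀ y ∈ S, ∃ t ∈ F, ∀ x, dist x y < ρ → φ y < g t x) ?_ ?_ ?_ ?_
  · exact ⟨∅, 1, one_pos, by simp⟩
  · rintro S S' hS ⟨F, ρ, hρ, hF⟩
    exact ⟨F, ρ, hρ, fun y hy => hF y (hS hy)⟩
  · rintro S S' ⟨F, ρ, hρ, hF⟩ ⟨F', ρ', hρ', hF'⟩
    refine ⟨F ∪ F', min ρ ρ', lt_min hρ hρ', ?_⟩
    rintro y (hy | hy)
    · obtain ⟨t, ht, H⟩ := hF y hy
      exact ⟨t, Finset.mem_union_left _ ht, fun x hx => H x (hx.trans_le (min_le_left _ _))⟩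
    · obtain ⟨t, ht, H⟩ := hF' y hy
      exact ⟨t, Finset.mem_union_right _ ht, fun x hx => H x (hx.trans_le (min_le_right _ _))⟩
  · intro y hy
    obtain ⟨t, ht⟩ := h y hy
    obtain ⟨c, hc1, hc2⟩ := exists_between ht
    obtain ⟨ρ, hρ, hρg⟩ := Metric.eventually_nhds_iff_ball.1 (hg t y c hc2)
    have hφc : ∀ᶠ y' in 𝓝 y, φ y' < c := hφ.continuousAt.eventually_lt continuousAt_const hc1
    refine ⟨{y' | φ y' < c} ∩ Metric.ball y (ρ / 2),
      mem_nhdsWithin_of_mem_nhds (inter_mem hφc (Metric.ball_mem_nhds y (half_pos hρ))),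
      {t}, ρ / 2, half_pos hρ, ?_⟩
    rintro y' ⟨hy'c, hy'⟩
    refine ⟨t, Finset.mem_singleton_self t, fun x hx => lt_trans hy'c (hρg x ?_)⟩
    rw [Metric.mem_ball] at hy' ⊢
    linarith [dist_triangle x y' y]

/-! ### Approximate multipliers for a finite maximum -/




/-- Approximate multiplier rule for a finite maximum of lower semicontinuous functions. If `x₀` is
an approximate minimiser of `max g - xs` up to the perturbation `ε ‖· - x₀‖`, the problem in which
every `g j` receives a variable of its own, tied to a common point by a quadratic penalty, and the
maximum is replaced by `logSumExp`, has a minimiser; its softmax weights are the multipliers. -/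
theorem exists_multipliers_of_fintype [FiniteDimensional ℝ X] {J : Type*} [Fintype J] [Nonempty J]
    {g : J → X → ℝ} (hg : ∀ j, LowerSemicontinuous (g j)) {x₀ : X} {xs : StrongDual ℝ X}
    {m ε R δ ρ : ℝ} (hε : 0 < ε) (hδ : 0 < δ) (hρ : 0 < ρ) (hR : 2 * δ / ε + ρ < R)
    (h₀ : ∀ j, g j x₀ ≤ m)
    (huni : ∀ y ∈ Metric.closedBall x₀ R, ∃ j, ∀ x, dist x y < ρ →
      m + xs (y - x₀) - ε * ‖y - x₀‖ - δ < g j x) :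
    ∃ (w : J → ℝ) (x : J → X) (v : J → StrongDual ℝ X),
      (∀ j, 0 < w j) ∧ ∑ j, w j = 1 ∧ (∀ j, dist (x j) x₀ < 2 * δ / ε + ρ) ∧
      (∀ j, g j (x j) ≤ m + δ + ‖xs‖ * (2 * δ / ε)) ∧
      m - 2 * δ - (‖xs‖ + ε) * (2 * δ / ε) ≤ ∑ j, w j * g j (x j) ∧
      ‖∑ j, w j • v j - xs‖ ≤ 2 * ε ∧
      ∀ j, ∃ C : ℝ, ∀ᶠ h in 𝓝 (0 : X), g j (x j) + v j h - C * ‖h‖ ^ 2 ≤ g j (x j + h) := by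
  classical
  obtain ⟨b, c, hc, hsymm, hpd⟩ := exists_posDef_bilin X
  have hR0 : 0 < R := by
    have : 0 < 2 * δ / ε := by positivity
    linarith
  have hq0 : ∀ u, 0 ≤ b u u := fun u => le_trans (by positivity) (hpd u)
  obtain ⟨N, hN, hcard⟩ : ∃ N : ℝ, 0 < N ∧ (Fintype.card J : ℝ) / N ≤ δ := by
    refine ⟨(Fintype.card J + 1) / δ, by positivity, ?_⟩
    rw [div_div_eq_mul_div, div_le_iff₀ (by positivity)]
    nlinarith
  set B : Set X := Metric.closedBall x₀ R with hB
  have hBc : IsCompact B := isCompact_closedBall x₀ R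
  have hx₀B : x₀ ∈ B := Metric.mem_closedBall_self hR0.le
  let j₁ : J := Classical.arbitrary J
  obtain ⟨μ, hμ⟩ : ∃ μ, ∀ x ∈ B, μ ≤ g j₁ x := by
    obtain ⟨a, -, ha⟩ := LowerSemicontinuousOn.exists_isMinOn ⟨x₀, hx₀B⟩ hBc
      ((hg j₁).lowerSemicontinuousOn B)
    exact ⟨g j₁ a, fun x hx => ha hx⟩
  -- the penalty is so strong that at a minimiser all variables lie within `ρ` of the common point
  obtain ⟨k, hk0, hk⟩ : ∃ k : ℝ, 0 < k ∧ m + δ - μ + ‖xs‖ * R < k * (c * ρ ^ 2) := by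
    refine ⟨(|m + δ - μ + ‖xs‖ * R| + 1) / (c * ρ ^ 2), by positivity, ?_⟩
    rw [div_mul_cancel₀ _ (by positivity)]
    linarith [le_abs_self (m + δ - μ + ‖xs‖ * R)]
  -- the extra `ε` in the coefficient of `‖y - x₀‖` makes `x₀` a strict approximate minimiser
  let Φ : (J → X) × X → ℝ := fun p =>
    logSumExp N (fun j => g j (p.1 j)) +
      (k * ∑ j, b (p.1 j - p.2) (p.1 j - p.2) - xs (p.2 - x₀) + 2 * ε * ‖p.2 - x₀‖)
  have hΦ : LowerSemicontinuous Φ := by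
    refine LowerSemicontinuous.add (lowerSemicontinuous_logSumExp hN
      (g := fun j (p : (J → X) × X) => g j (p.1 j)) fun j =>
        (hg j).comp ((continuous_apply j).comp continuous_fst)) (Continuous.lowerSemicontinuous ?_)
    have h1 : ∀ j, Continuous fun p : (J → X) × X => b (p.1 j - p.2) (p.1 j - p.2) := fun j => by
      have h2 : Continuous fun p : (J → X) × X => p.1 j - p.2 := by fun_prop
      exact (b.continuous.comp h2).clm_apply h2
    have h3 : Continuous fun p : (J → X) × X => ∑ j, b (p.1 j - p.2) (p.1 j - p.2) :=
      continuous_finsetSum _ fun j _ => h1 j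
    fun_prop
  have hKc : IsCompact ((Set.univ.pi fun _ : J => B) ×ˢ B) :=
    (isCompact_univ_pi fun _ => hBc).prod hBc
  have hKne : ((Set.univ.pi fun _ : J => B) ×ˢ B).Nonempty :=
    ⟨(fun _ => x₀, x₀), fun _ _ => hx₀B, hx₀B⟩
  obtain ⟨⟨x, y⟩, ⟨hxB, hyB⟩, hmin⟩ := LowerSemicontinuousOn.exists_isMinOn hKne hKc
    (hΦ.lowerSemicontinuousOn _)
  have hxB : ∀ j, x j ∈ B := fun j => hxB j (mem_univ j)
  have hyB : y ∈ B := hyB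
  have hmin : ∀ x' y', (∀ j, x' j ∈ B) → y' ∈ B → Φ (x, y) ≤ Φ (x', y') :=
    fun x' y' hx' hy' => hmin ⟨fun j _ => hx' j, hy'⟩
  set v₀ : J → ℝ := fun j => g j (x j) with hv₀
  have hval : Φ (x, y) ≤ m + δ := by
    refine (hmin (fun _ => x₀) x₀ (fun _ => hx₀B) hx₀B).trans ?_
    have := logSumExp_le hN h₀
    simp only [Φ, sub_self, map_zero, Finset.sum_const_zero, mul_zero, norm_zero]
    linarith
  have hΦdef : Φ (x, y) = logSumExp N v₀ +
      (k * ∑ j, b (x j - y) (x j - y) - xs (y - x₀) + 2 * ε * ‖y - x₀‖) := rfl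
  have hsumq : ∀ j, b (x j - y) (x j - y) ≤ ∑ j, b (x j - y) (x j - y) := fun j =>
    Finset.single_le_sum (f := fun j => b (x j - y) (x j - y)) (fun j _ => hq0 _) (Finset.mem_univ j)
  have hsumq0 : 0 ≤ k * ∑ j, b (x j - y) (x j - y) :=
    mul_nonneg hk0.le (Finset.sum_nonneg fun j _ => hq0 _)
  have hxsy : |xs (y - x₀)| ≤ ‖xs‖ * ‖y - x₀‖ := xs.le_opNorm _
  have hyR : ‖y - x₀‖ ≤ R := by rw [← dist_eq_norm]; exact hyB
  have hny : 0 ≤ ‖y - x₀‖ := norm_nonneg _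
  have hxy : ∀ j, dist (x j) y < ρ := by
    intro j
    by_contra! hcon
    have h1 : c * ρ ^ 2 ≤ b (x j - y) (x j - y) := by
      refine le_trans ?_ (hpd _)
      rw [← dist_eq_norm]
      gcongr
    have h2 : k * (c * ρ ^ 2) ≤ k * ∑ j, b (x j - y) (x j - y) :=
      mul_le_mul_of_nonneg_left (h1.trans (hsumq j)) hk0.le
    have h3 := (hμ _ (hxB j₁)).trans (le_logSumExp hN v₀ j₁)
    have h4 : ‖xs‖ * ‖y - x₀‖ ≤ ‖xs‖ * R := by gcongr
    have h5 : 0 ≤ 2 * ε * ‖y - x₀‖ := by positivity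
    linarith [(abs_le.1 hxsy).2]
  -- the member that is large near `y` bounds the value from below, which forces `y` close to `x₀`
  obtain ⟨j₀, hj₀⟩ := huni y hyB
  have hlow : m + xs (y - x₀) - ε * ‖y - x₀‖ - δ < logSumExp N v₀ :=
    (hj₀ _ (hxy j₀)).trans_le (le_logSumExp hN v₀ j₀)
  have hy : ‖y - x₀‖ < 2 * δ / ε := by
    rw [lt_div_iff₀ hε]
    linarith
  have hxsy' : |xs (y - x₀)| ≤ ‖xs‖ * (2 * δ / ε) := hxsy.trans (by gcongr)
  have hxx₀ : ∀ j, dist (x j) x₀ < 2 * δ / ε + ρ := fun j => by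
    have h1 := dist_triangle (x j) y x₀
    have h2 := hxy j
    rw [dist_eq_norm y x₀] at h1
    linarith
  have hnhds : ∀ z, dist z x₀ < R → ∀ᶠ h in 𝓝 (0 : X), z + h ∈ B := by
    intro z hz
    have : Tendsto (fun h => z + h) (𝓝 0) (𝓝 z) := by
      have : Continuous fun h => z + h := by fun_prop
      simpa using this.tendsto 0
    exact this.eventually (Metric.closedBall_mem_nhds_of_mem (Metric.mem_ball.2 hz))
  set w : J → ℝ := softmaxWeight N v₀ with hw
  have hw0 : ∀ j, 0 < w j := fun j => softmaxWeight_pos v₀ j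
  refine ⟨w, x, fun j => -(2 * k / w j) • b (x j - y), hw0, sum_softmaxWeight v₀, hxx₀,
    ?_, ?_, ?_, ?_⟩
  · intro j
    have h1 := le_logSumExp hN v₀ j
    have h2 : 0 ≤ 2 * ε * ‖y - x₀‖ := by positivity
    have h3 := (abs_le.1 hxsy').2
    have h4 : v₀ j = g j (x j) := rfl
    linarith
  · have h1 := logSumExp_sub_le_sum_softmaxWeight_mul hN v₀
    have h3 := (abs_le.1 hxsy').1
    have h4 : ε * ‖y - x₀‖ ≤ ε * (2 * δ / ε) := by gcongr
    have h5 : (‖xs‖ + ε) * (2 * δ / ε) = ‖xs‖ * (2 * δ / ε) + ε * (2 * δ / ε) := by ring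
    rw [h5]
    linarith
  · have hsum : ∑ j, w j • (-(2 * k / w j) • b (x j - y)) = -((2 * k) • ∑ j, b (x j - y)) := by
      rw [Finset.smul_sum, ← Finset.sum_neg_distrib]
      refine Finset.sum_congr rfl fun j _ => ?_
      rw [smul_smul, ← neg_smul]
      congr 1
      have := (hw0 j).ne'
      field_simp
    rw [hsum]
    -- optimality in the common point
    refine opNorm_le_of_eventually_nonneg (C := k * (Fintype.card J * ‖b‖)) (by positivity) ?_
    filter_upwards [hnhds y (by rw [dist_eq_norm]; linarith)] with h hh
    have h1 := hmin x (y + h) hxB hh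
    have h2 : ∀ j, b (x j - (y + h)) (x j - (y + h)) =
        b (x j - y) (x j - y) + (b h h - 2 * b (x j - y) h) := fun j => by
      have : x j - (y + h) = (x j - y) - h := by abel
      rw [this]
      simp only [map_sub, sub_apply]
      have := hsymm h (x j)
      have := hsymm h y
      linarith
    have h3 : b h h ≤ ‖b‖ * ‖h‖ ^ 2 := by
      have := (le_abs_self _).trans (b.le_opNorm₂ h h)
      linarith [this, sq ‖h‖]
    have h4 : k * (Fintype.card J * b h h) ≤ k * (Fintype.card J * (‖b‖ * ‖h‖ ^ 2)) := by gcongr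
    have h5 : ‖y + h - x₀‖ ≤ ‖y - x₀‖ + ‖h‖ := by
      have : y + h - x₀ = (y - x₀) + h := by abel
      rw [this]; exact norm_add_le _ _
    have h6 : 2 * ε * ‖y + h - x₀‖ ≤ 2 * ε * ‖y - x₀‖ + 2 * ε * ‖h‖ := by
      rw [← mul_add]; gcongr
    have h7 : xs (y + h - x₀) = xs (y - x₀) + xs h := by
      rw [← map_add]; congr 1; abel
    have h8 : (∑ j, b (x j - y)) h = ∑ j, b (x j - y) h := by
      simp
    simp only [Φ, h2, Finset.sum_add_distrib, Finset.sum_sub_distrib, ← Finset.mul_sum,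
      Finset.sum_const, Finset.card_univ, nsmul_eq_mul, h7] at h1
    simp only [sub_apply, neg_apply, smul_apply, h8, smul_eq_mul]
    linarith
  · intro j
    -- optimality in the variable of `g j`
    refine eventually_quadratic_minorant hN (hw0 j) b ?_
    filter_upwards [hnhds (x j) ((hxx₀ j).trans hR)] with h hh
    have h1 := hmin (Function.update x j (x j + h)) y (fun i => by
      rcases eq_or_ne i j with rfl | hij
      · simpa using hh
      · simpa [hij] using hxB i) hyB
    have h2 : (fun i => g i (Function.update x j (x j + h) i)) =
        Function.update v₀ j (g j (x j + h)) := by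
      funext i
      rcases eq_or_ne i j with rfl | hij
      · simp
      · simp [hij, v₀]
    have h3 : ∑ i, b (Function.update x j (x j + h) i - y) (Function.update x j (x j + h) i - y) =
        ∑ i, b (x i - y) (x i - y) + (2 * b (x j - y) h + b h h) := by
      rw [← Finset.add_sum_erase _ _ (Finset.mem_univ j),
        ← Finset.add_sum_erase _ (fun i => b (x i - y) (x i - y)) (Finset.mem_univ j)]
      have h4 : ∑ i ∈ Finset.univ.erase j,
          b (Function.update x j (x j + h) i - y) (Function.update x j (x j + h) i - y) =
          ∑ i ∈ Finset.univ.erase j, b (x i - y) (x i - y) :=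
        Finset.sum_congr rfl fun i hi => by rw [Function.update_of_ne (Finset.ne_of_mem_erase hi)]
      have h5 : x j + h - y = (x j - y) + h := by abel
      rw [h4, Function.update_self, h5]
      simp only [map_add, map_sub, add_apply, sub_apply]
      have := hsymm h (x j)
      have := hsymm h y
      linarith
    have h4 := logSumExp_update_le hN v₀ j (g j (x j + h))
    simp only [Φ, h2, h3] at h1
    have h5 : logSumExp N (fun j => g j (x j)) = logSumExp N v₀ := rfl
    have h6 : v₀ j = g j (x j) := rfl
    rw [h6] at h4
    linarith

/-! ### The approximate subdifferential rule for suprema -/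


theorem mem_frechetSub_of_quadratic_minorant {f : X → EReal} {x : X} {r C : ℝ} {v : StrongDual ℝ X}
    (hr : f x = r) (h : ∀ᶠ h in 𝓝 (0 : X), ((r + v h - C * ‖h‖ ^ 2 : ℝ) : EReal) ≤ f (x + h)) :
    v ∈ frechetSub f x := by
  refine mem_frechetSub_iff.2 ⟨r, hr, fun ε hε => ?_⟩
  filter_upwards [h, Metric.ball_mem_nhds (0 : X) (show 0 < ε / (|C| + 1) by positivity)]
    with z hz hzb
  refine le_trans (EReal.coe_le_coe_iff.2 ?_) hz
  have h1 : ‖z‖ < ε / (|C| + 1) := mem_ball_zero_iff.1 hzb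
  rw [lt_div_iff₀ (by positivity)] at h1
  have h2 : C * ‖z‖ ≤ ε := by
    nlinarith [le_abs_self C, norm_nonneg z]
  nlinarith [norm_nonneg z, mul_le_mul_of_nonneg_right h2 (norm_nonneg z)]

/-- A Fréchet subgradient of a supremum is approximately a convex combination of Fréchet subgradients
of members of the family at nearby points. The second coordinate records the function values: none
is much above the value of the supremum, and their weighted mean is close to it. -/
theorem exists_mem_convexHull_of_mem_frechetSub_supFun [FiniteDimensional ℝ X] {ι : Type*}
    {f : ι → X → EReal} (hbot : ∀ t x, f t x ≠ ⊥) (hlsc : ∀ t, LowerSemicontinuous (f t))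
    {x₀ : X} {xs : StrongDual ℝ X} (hxs : xs ∈ frechetSub (supFun f) x₀) {m : ℝ}
    (hm : supFun f x₀ = m) {η : ℝ} (hη : 0 < η) :
    ∃ p ∈ convexHull ℝ {p : StrongDual ℝ X × ℝ | ∃ t x, p.1 ∈ frechetSub (f t) x ∧
        f t x = p.2 ∧ dist x x₀ < η ∧ p.2 ≤ m + η},
      ‖p.1 - xs‖ ≤ η ∧ m - η ≤ p.2 := by
  obtain ⟨r, hr, hsub⟩ := mem_frechetSub_iff.1 hxs
  obtain rfl : r = m := by rw [hm] at hr; exact_mod_cast hr.symm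
  set ε : ℝ := η / 2 with hε
  have hε0 : 0 < ε := half_pos hη
  obtain ⟨R₀, hR₀, hR₀'⟩ := Metric.eventually_nhds_iff_ball.1 (hsub ε hε0)
  set R : ℝ := R₀ / 2 with hR
  have hR0 : 0 < R := half_pos hR₀
  set A : ℝ := min R η with hA
  have hA0 : 0 < A := lt_min hR0 hη
  set δ : ℝ := A / (4 * (2 + 2 / ε + 2 * (‖xs‖ + ε) / ε)) with hδ
  have hδ0 : 0 < δ := by positivity
  have hδA : 2 * δ + 2 * δ / ε + (‖xs‖ + ε) * (2 * δ / ε) = A / 4 := by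
    have h1 : δ * (4 * (2 + 2 / ε + 2 * (‖xs‖ + ε) / ε)) = A := div_mul_cancel₀ _ (by positivity)
    rw [← h1]; ring
  have hAR : A ≤ R := min_le_left _ _
  have hAη : A ≤ η := min_le_right _ _
  have hn1 : 0 < 2 * δ / ε := by positivity
  have hn2 : 0 ≤ ‖xs‖ * (2 * δ / ε) := by positivity
  have hn3 : 0 ≤ ε * (2 * δ / ε) := by positivity
  rw [add_mul] at hδA
  -- truncation makes the family real-valued without affecting it below the level `C`
  set C : ℝ := r + ‖xs‖ * R + η + 1 with hC
  let g : ι → X → ℝ := fun t x => (min (f t x) C).toReal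
  have hgcoe : ∀ t x, (g t x : EReal) = min (f t x) C := fun t x => by
    refine EReal.coe_toReal (ne_of_lt ?_) (ne_of_gt ?_)
    · exact (min_le_right _ _).trans_lt (EReal.coe_lt_top C)
    · exact lt_min (bot_lt_iff_ne_bot.2 (hbot t x)) (EReal.bot_lt_coe C)
  have hlt : ∀ t x (a : ℝ), a < g t x ↔ (a : EReal) < f t x ∧ a < C := fun t x a => by
    rw [← EReal.coe_lt_coe_iff, hgcoe, lt_min_iff, EReal.coe_lt_coe_iff]
  have hg : ∀ t, LowerSemicontinuous (g t) := fun t x a ha => by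
    obtain ⟨h1, h2⟩ := (hlt t x a).1 ha
    filter_upwards [hlsc t x a h1] with z hz using (hlt t z a).2 ⟨hz, h2⟩
  have hgf : ∀ t x, (g t x : EReal) ≤ f t x := fun t x => by
    rw [hgcoe]; exact min_le_left _ _
  have hg₀ : ∀ t, g t x₀ ≤ r := fun t => by
    have : (g t x₀ : EReal) ≤ r := (hgf t x₀).trans (hm ▸ le_iSup (fun t => f t x₀) t)
    exact_mod_cast this
  have hpt : ∀ y ∈ Metric.closedBall x₀ R, ∃ t,
      r + xs (y - x₀) - ε * ‖y - x₀‖ - δ < g t y := by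
    intro y hy
    have hy' : ‖y - x₀‖ ≤ R := by rw [← dist_eq_norm]; exact hy
    have h1 := hR₀' (y - x₀) (mem_ball_zero_iff.2 (by linarith))
    rw [add_sub_cancel] at h1
    have h2 : ((r + xs (y - x₀) - ε * ‖y - x₀‖ - δ : ℝ) : EReal) < supFun f y :=
      lt_of_lt_of_le (EReal.coe_lt_coe_iff.2 (by linarith)) h1
    obtain ⟨t, ht⟩ := lt_iSup_iff.1 h2
    refine ⟨t, (hlt _ _ _).2 ⟨ht, ?_⟩⟩
    have h3 : xs (y - x₀) ≤ ‖xs‖ * R :=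
      (le_abs_self _).trans ((xs.le_opNorm _).trans (by gcongr))
    have h4 : 0 ≤ ε * ‖y - x₀‖ := by positivity
    linarith
  have hφ : Continuous fun y => r + xs (y - x₀) - ε * ‖y - x₀‖ - δ := by fun_prop
  obtain ⟨F, ρ, hρ, hF⟩ := exists_finset_uniform_lt hg hφ (isCompact_closedBall x₀ R) hpt
  obtain ⟨t₀, ht₀, -⟩ := hF x₀ (Metric.mem_closedBall_self hR0.le)
  have : Nonempty F := ⟨⟨t₀, ht₀⟩⟩
  obtain ⟨w, x, v, hw0, hw1, hx, hgx, hmean, hv, hmin⟩ :=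
    exists_multipliers_of_fintype (J := F) (g := fun t => g t) (fun t => hg t) (x₀ := x₀)
      (xs := xs) (m := r) (ρ := min ρ (A / 4)) hε0 hδ0 (lt_min hρ (by positivity))
      (R := R) (by have := min_le_right ρ (A / 4); linarith) (fun t => hg₀ t)
      (fun y hy => by
        obtain ⟨t, ht, h⟩ := hF y hy
        exact ⟨⟨t, ht⟩, fun x hx => h x (hx.trans_le (min_le_left _ _))⟩)
  refine ⟨∑ t, w t • (v t, g t (x t)), ?_, ?_, ?_⟩
  · refine (convex_convexHull ℝ _).sum_mem (fun t _ => (hw0 t).le) hw1 fun t _ => ?_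
    refine subset_convexHull ℝ _ ?_
    have h1 : g t (x t) ≤ r + η := by linarith [hgx t]
    have h2 : f t (x t) = g t (x t) := by
      have h3 : g t (x t) < C := by
        have : 0 ≤ ‖xs‖ * R := by positivity
        linarith
      rw [hgcoe]
      refine (min_eq_left ?_).symm
      by_contra! hcon
      have := hgcoe t (x t)
      rw [min_eq_right hcon.le] at this
      exact h3.ne (by exact_mod_cast this)
    obtain ⟨D, hD⟩ := hmin t
    refine ⟨t, x t, mem_frechetSub_of_quadratic_minorant h2 (C := D) ?_, h2, ?_, h1⟩
    · filter_upwards [hD] with h hh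
      exact (EReal.coe_le_coe_iff.2 hh).trans (hgf _ _)
    · have := min_le_right ρ (A / 4)
      linarith [hx t]
  · have : (∑ t, w t • (v t, g t (x t))).1 = ∑ t, w t • v t := by
      simp [Prod.fst_sum]
    rw [this]
    linarith
  · have : (∑ t, w t • (v t, g t (x t))).2 = ∑ t, w t * g t (x t) := by
      simp [Prod.snd_sum]
    rw [this]
    linarith

/-! ### Convex hulls: number of points, and cones -/

/-- Carathéodory's theorem with a number of points that depends only on the dimension; vanishing
weights are allowed. -/
theorem exists_fin_of_mem_convexHull {E : Type*} [AddCommGroup E] [Module ℝ E]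
    [FiniteDimensional ℝ E] {s : Set E} {p : E} (hp : p ∈ convexHull ℝ s) :
    ∃ (z : Fin (Module.finrank ℝ E + 1) → E) (w : Fin (Module.finrank ℝ E + 1) → ℝ),
      (∀ j, z j ∈ s) ∧ (∀ j, 0 ≤ w j) ∧ ∑ j, w j = 1 ∧ ∑ j, w j • z j = p := by
  classical
  obtain ⟨a, ha⟩ : s.Nonempty := convexHull_nonempty_iff.1 ⟨p, hp⟩
  obtain ⟨ι, _, z, w, hz, hind, hw0, hw1, hwz⟩ := eq_pos_convex_span_of_mem_convexHull hp
  have hcard : Fintype.card ι ≤ Fintype.card (Fin (Module.finrank ℝ E + 1)) := by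
    rw [Fintype.card_fin]
    exact hind.card_le_finrank_succ.trans
      (Nat.succ_le_succ (Submodule.finrank_le _))
  obtain ⟨e⟩ := Function.Embedding.nonempty_of_card_le hcard
  set z' := Function.extend e z fun _ => a with hz'
  set w' := Function.extend e w fun _ => (0 : ℝ) with hw'
  have hze : ∀ i, z' (e i) = z i := e.injective.extend_apply z _
  have hwe : ∀ i, w' (e i) = w i := e.injective.extend_apply w _
  have hz0 : ∀ j ∉ Set.range e, z' j = a := fun j hj => Function.extend_apply' z _ j hj
  have hw0' : ∀ j ∉ Set.range e, w' j = 0 := fun j hj => Function.extend_apply' w _ j hj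
  refine ⟨z', w', fun j => ?_, fun j => ?_, ?_, ?_⟩
  · by_cases hj : j ∈ Set.range e
    · obtain ⟨i, rfl⟩ := hj
      rw [hze]; exact hz ⟨i, rfl⟩
    · rw [hz0 j hj]; exact ha
  · by_cases hj : j ∈ Set.range e
    · obtain ⟨i, rfl⟩ := hj
      rw [hwe]; exact (hw0 i).le
    · rw [hw0' j hj]
  · rw [← hw1]
    exact (Fintype.sum_of_injective e e.injective _ _ hw0' fun i => (hwe i).symm).symm
  · rw [← hwz]
    refine (Fintype.sum_of_injective e e.injective _ _ (fun j hj => ?_) fun i => ?_).symm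
    · rw [hw0' j hj, zero_smul]
    · rw [hze, hwe]

section Cone

variable {V : Type*} [AddCommGroup V] [Module ℝ V] {S : Set V} {J : Type*}

theorem sum_mem_convexHull_of_cone (hS : ∀ a : ℝ, 0 < a → ∀ v ∈ S, a • v ∈ S) {I : Finset J}
    (hI : I.Nonempty) {z : J → V} (hz : ∀ j ∈ I, z j ∈ S) : ∑ j ∈ I, z j ∈ convexHull ℝ S := by
  have hc : (0 : ℝ) < I.card := by exact_mod_cast hI.card_pos
  have h1 : ∑ j ∈ I, z j = ∑ j ∈ I, (I.card : ℝ)⁻¹ • ((I.card : ℝ) • z j) :=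
    Finset.sum_congr rfl fun j _ => by rw [smul_smul, inv_mul_cancel₀ hc.ne', one_smul]
  rw [h1]
  refine (convex_convexHull ℝ S).sum_mem (fun _ _ => by positivity) ?_ fun j hj =>
    subset_convexHull ℝ S (hS _ hc _ (hz j hj))
  rw [Finset.sum_const, nsmul_eq_mul, mul_inv_cancel₀ hc.ne']

/-- If elements of a cone sum to zero without all vanishing, then the opposite of one of them is a
sum of the others, so the convex hull of the cone contains a line. -/
theorem containsLine_of_sum_eq_zero [Fintype J] (hS : ∀ a : ℝ, 0 < a → ∀ v ∈ S, a • v ∈ S)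
    {z : J → V} (hz : ∀ j, z j ∈ S) (hsum : ∑ j, z j = 0) (hne : z ≠ 0) :
    ContainsLine (convexHull ℝ S) := by
  classical
  obtain ⟨i, hi⟩ := Function.ne_iff.1 hne
  have hi : z i ≠ 0 := hi
  have hsplit : z i + ∑ j ∈ Finset.univ.erase i, z j = 0 := by
    rw [Finset.add_sum_erase _ _ (Finset.mem_univ i), hsum]
  have hne' : (Finset.univ.erase i).Nonempty := by
    by_contra! hemp
    rw [hemp, Finset.sum_empty, add_zero] at hsplit
    exact hi hsplit
  refine ⟨0, z i, hi, fun a => ?_⟩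
  rw [zero_add]
  rcases lt_trichotomy a 0 with ha | rfl | ha
  · have h1 : a • z i = ∑ j ∈ Finset.univ.erase i, (-a) • z j := by
      rw [← Finset.smul_sum, eq_neg_of_add_eq_zero_left hsplit, smul_neg, neg_smul]
    rw [h1]
    exact sum_mem_convexHull_of_cone hS hne' fun j _ => hS _ (neg_pos.2 ha) _ (hz j)
  · rw [zero_smul, ← hsum]
    exact sum_mem_convexHull_of_cone hS ⟨i, Finset.mem_univ i⟩ fun j _ => hz j
  · exact subset_convexHull ℝ S (hS a ha _ (hz i))

end Cone

/-! ### Limits of weighted subgradients of members of the family -/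

variable {M : Type*} [MetricSpace M] {T : Set M} {f : T → X → EReal} {x₀ : X}

theorem smul_mem_extSingularSub {t : M} {v : StrongDual ℝ X} {a : ℝ} (ha : 0 < a)
    (hv : v ∈ extSingularSub f t x₀) : a • v ∈ extSingularSub f t x₀ := by
  have key : ∀ η : ℕ → ℝ, Tendsto η atTop (𝓝[>] 0) → Tendsto (fun n => a * η n) atTop (𝓝[>] 0) := by
    intro η hη
    rw [tendsto_nhdsWithin_iff] at hη ⊢
    refine ⟨by simpa using hη.1.const_mul a, ?_⟩
    filter_upwards [hη.2] with n hn using mul_pos ha hn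
  by_cases ht : t ∈ T
  · simp only [extSingularSub, dif_pos ht] at hv ⊢
    obtain ⟨h1, h2, u, us, η, h3, h4, h5, h6, h7⟩ := hv
    refine ⟨h1, h2, u, us, fun n => a * η n, h3, h4, h5, key η h6, ?_⟩
    simpa only [mul_smul] using h7.const_smul a
  · simp only [extSingularSub, dif_neg ht] at hv ⊢
    obtain ⟨s, η, u, us, h1, h2, h3, h4, h5, h6⟩ := hv
    refine ⟨s, fun n => a * η n, u, us, h1, key η h2, h3, h4, h5, ?_⟩
    simpa only [mul_smul] using h6.const_smul a

theorem smul_mem_iUnion_extSingularSub (a : ℝ) (ha : 0 < a) (v : StrongDual ℝ X)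
    (hv : v ∈ ⋃ t ∈ closure T, extSingularSub f t x₀) :
    a • v ∈ ⋃ t ∈ closure T, extSingularSub f t x₀ := by
  obtain ⟨t, ht, hv⟩ := mem_iUnion₂.1 hv
  exact mem_iUnion₂.2 ⟨t, ht, smul_mem_extSingularSub ha hv⟩

/-- Limits with vanishing, possibly zero, weights are singular subgradients: at an index of `T` this
is continuous subdifferentiability, elsewhere the weights are made positive by a perturbation that
is negligible against the subgradients. -/
theorem mem_extSingularSub_of_tendsto (hb : ContinuouslySubdifferentiable f x₀) {t₀ : M}
    {s : ℕ → T} {l : ℕ → ℝ} {u : ℕ → X} {us : ℕ → StrongDual ℝ X} {v : StrongDual ℝ X}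
    (hs : Tendsto (fun k => (s k : M)) atTop (𝓝 t₀)) (hl0 : ∀ k, 0 ≤ l k)
    (hl : Tendsto l atTop (𝓝 0)) (hu : Tendsto u atTop (𝓝 x₀))
    (hus : ∀ k, us k ∈ frechetSub (f (s k)) (u k))
    (hval : limsup (fun k => f (s k) (u k)) atTop ≤ supFun f x₀)
    (hv : Tendsto (fun k => l k • us k) atTop (𝓝 v)) : v ∈ extSingularSub f t₀ x₀ := by
  by_cases ht : t₀ ∈ T
  · simp only [extSingularSub, dif_pos ht]
    rcases hb s u l us ⟨t₀, ht⟩ 0 v hl0 (tendsto_subtype_rng.2 hs) hu hl hus hv with h | h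
    · exact absurd h.1 (lt_irrefl _)
    · exact h.2
  · simp only [extSingularSub, dif_neg ht]
    set d : ℕ → ℝ := fun k => 1 / ((k : ℝ) + 1) / (1 + ‖us k‖) with hd
    have hd0 : ∀ k, 0 < d k := fun k => by positivity
    have hle : ∀ k, d k ≤ 1 / ((k : ℝ) + 1) := fun k =>
      div_le_self (by positivity) (by linarith [norm_nonneg (us k)])
    have hdus : ∀ k, ‖d k • us k‖ ≤ 1 / ((k : ℝ) + 1) := fun k => by
      rw [norm_smul, Real.norm_of_nonneg (hd0 k).le, hd, div_mul_eq_mul_div,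
        div_le_iff₀ (by positivity)]
      have : (0 : ℝ) ≤ 1 / ((k : ℝ) + 1) := by positivity
      nlinarith
    have hdt : Tendsto d atTop (𝓝 0) :=
      squeeze_zero (fun k => (hd0 k).le) hle tendsto_one_div_add_atTop_nhds_zero_nat
    have hdt' : Tendsto (fun k => d k • us k) atTop (𝓝 0) :=
      squeeze_zero_norm hdus tendsto_one_div_add_atTop_nhds_zero_nat
    refine ⟨s, fun k => l k + d k, u, us, hs, ?_, hu, hus, hval, ?_⟩
    · refine tendsto_nhdsWithin_iff.2 ⟨by simpa using hl.add hdt, Eventually.of_forall fun k => ?_⟩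
      exact add_pos_of_nonneg_of_pos (hl0 k) (hd0 k)
    · simpa only [add_smul, add_zero] using hv.add hdt'

/-- Limits with nonvanishing weights are, after division by the limit weight, limiting subgradients,
provided that the function values tend to that of the supremum. -/
theorem inv_smul_mem_extLimitingSub_of_tendsto (hb : ContinuouslySubdifferentiable f x₀) {t₀ : M}
    {s : ℕ → T} {l : ℕ → ℝ} {l₀ : ℝ} {u : ℕ → X} {us : ℕ → StrongDual ℝ X} {v : StrongDual ℝ X}
    (hs : Tendsto (fun k => (s k : M)) atTop (𝓝 t₀)) (hl0 : ∀ k, 0 ≤ l k) (hl₀ : 0 < l₀)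
    (hl : Tendsto l atTop (𝓝 l₀)) (hu : Tendsto u atTop (𝓝 x₀))
    (hus : ∀ k, us k ∈ frechetSub (f (s k)) (u k))
    (hval : Tendsto (fun k => f (s k) (u k)) atTop (𝓝 (supFun f x₀)))
    (hv : Tendsto (fun k => l k • us k) atTop (𝓝 v)) : l₀⁻¹ • v ∈ extLimitingSub f t₀ x₀ := by
  by_cases ht : t₀ ∈ T
  · simp only [extLimitingSub, dif_pos ht]
    rcases hb s u l us ⟨t₀, ht⟩ l₀ v hl0 (tendsto_subtype_rng.2 hs) hu hl hus hv with h | h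
    · obtain ⟨y, hy, hyv⟩ := h.2
      have hyv : l₀ • y = v := hyv
      rwa [← hyv, smul_smul, inv_mul_cancel₀ hl₀.ne', one_smul]
    · exact absurd h.1 hl₀.ne'
  · simp only [extLimitingSub, dif_neg ht]
    refine ⟨s, u, us, hs, hu, hus, hval, ?_⟩
    refine ((hl.inv₀ hl₀.ne').smul hv).congr' ?_
    filter_upwards [hl.eventually (lt_mem_nhds hl₀)] with k hk
    rw [smul_smul, inv_mul_cancel₀ hk.ne', one_smul]

/-- Joint upper semicontinuity at the indices of `T` makes a limit of asymptotically active indices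
active. -/
theorem mem_extActive_of_tendsto {Y : Type*} [TopologicalSpace Y] {f : T → Y → EReal} {x₀ : Y}
    (ha : ∀ t : T, limsup (fun p : T × Y => f p.1 p.2) (𝓝 (t, x₀)) ≤ f t x₀) {t₀ : M}
    (ht₀ : t₀ ∈ closure T) {s : ℕ → T} {u : ℕ → Y}
    (hs : Tendsto (fun k => (s k : M)) atTop (𝓝 t₀)) (hu : Tendsto u atTop (𝓝 x₀))
    (hval : Tendsto (fun k => f (s k) (u k)) atTop (𝓝 (supFun f x₀))) : t₀ ∈ extActive f x₀ := by
  by_cases ht : t₀ ∈ T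
  · refine Or.inl ⟨ht, le_trans ?_ (ha ⟨t₀, ht⟩)⟩
    have hp : Tendsto (fun k => (s k, u k)) atTop (𝓝 ((⟨t₀, ht⟩ : T), x₀)) :=
      (tendsto_subtype_rng.2 hs).prodMk_nhds hu
    have h1 : limsup (fun p : T × Y => f p.1 p.2) (map (fun k => (s k, u k)) atTop) ≤ _ :=
      limsup_le_limsup_of_le hp
    exact hval.limsup_eq.symm.trans_le h1
  · exact Or.inr ⟨ht₀, ht⟩

/-- A convergent subsequence of finitely many indices together with bounded weights and vectors. -/
theorem exists_subseq_tendsto [FiniteDimensional ℝ X] (hT : IsCompact (closure T)) {J : Type*}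
    [Fintype J] {s : ℕ → J → T} {W : ℕ → J → ℝ} {Z : ℕ → J → StrongDual ℝ X} {κ B : ℝ}
    (hW : ∀ n j, W n j ∈ Icc 0 κ) (hZ : ∃ᶠ n in atTop, ‖Z n‖ ≤ B) :
    ∃ (φ : ℕ → ℕ) (t₀ : J → M) (W₀ : J → ℝ) (Z₀ : J → StrongDual ℝ X), StrictMono φ ∧
      (∀ j, t₀ j ∈ closure T) ∧ (∀ j, Tendsto (fun n => (s (φ n) j : M)) atTop (𝓝 (t₀ j))) ∧
      (∀ j, Tendsto (fun n => W (φ n) j) atTop (𝓝 (W₀ j))) ∧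
      Tendsto (fun n => Z (φ n)) atTop (𝓝 Z₀) := by
  have hK : IsCompact ((Set.univ.pi fun _ : J => closure T) ×ˢ
      ((Set.univ.pi fun _ : J => Icc 0 κ) ×ˢ
        Metric.closedBall (0 : J → StrongDual ℝ X) B)) := by
    have : ProperSpace (J → StrongDual ℝ X) := FiniteDimensional.proper ℝ _
    exact (isCompact_univ_pi fun _ => hT).prod
      ((isCompact_univ_pi fun _ => isCompact_Icc).prod (isCompact_closedBall _ _))
  obtain ⟨⟨t₀, W₀, Z₀⟩, ⟨h1, -, -⟩, φ, hφ, hlim⟩ := hK.tendsto_subseq'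
    (x := fun n => ((fun j => (s n j : M)), W n, Z n))
    (hZ.mono fun n hn => ⟨fun j _ => subset_closure (s n j).2, fun j _ => hW n j,
      by simpa using hn⟩)
  have hlim1 := (continuous_fst.tendsto _).comp hlim
  have hlim2 := (continuous_snd.tendsto _).comp hlim
  have hlim3 := (continuous_fst.tendsto _).comp hlim2
  have hlim4 := (continuous_snd.tendsto _).comp hlim2
  exact ⟨φ, t₀, W₀, Z₀, hφ, fun j => h1 j (mem_univ j), fun j => tendsto_pi_nhds.1 hlim1 j,
    fun j => tendsto_pi_nhds.1 hlim3 j, hlim4⟩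

theorem limsup_comp_le {g : ℕ → EReal} {φ : ℕ → ℕ} (hφ : StrictMono φ) :
    limsup (fun n => g (φ n)) atTop ≤ limsup g atTop := by
  have h1 : limsup g (map φ atTop) ≤ limsup g atTop := limsup_le_limsup_of_le hφ.tendsto_atTop
  exact h1

/-- Since the cone of singular subgradients contains no line, weighted subgradients with a
convergent sum cannot be unbounded: normalised, they would converge to singular subgradients that
sum to zero without all vanishing. -/
theorem not_tendsto_norm_atTop [FiniteDimensional ℝ X] (hT : IsCompact (closure T))
    (hb : ContinuouslySubdifferentiable f x₀)
    (hc : ¬ ContainsLine (convexHull ℝ (⋃ t ∈ closure T, extSingularSub f t x₀)))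
    {J : Type*} [Fintype J] {s : ℕ → J → T} {u : ℕ → J → X} {us : ℕ → J → StrongDual ℝ X}
    {W : ℕ → J → ℝ} {κ : ℝ} {V : StrongDual ℝ X} (hW : ∀ n j, W n j ∈ Icc 0 κ)
    (hus : ∀ n j, us n j ∈ frechetSub (f (s n j)) (u n j))
    (hu : ∀ j, Tendsto (fun n => u n j) atTop (𝓝 x₀))
    (hval : ∀ j, limsup (fun n => f (s n j) (u n j)) atTop ≤ supFun f x₀)
    (hV : Tendsto (fun n => ∑ j, W n j • us n j) atTop (𝓝 V)) :
    ¬ Tendsto (fun n => ‖fun j => W n j • us n j‖) atTop atTop := by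
  intro hinf
  set A : ℕ → ℝ := fun n => ‖fun j => W n j • us n j‖ with hA
  set Z : ℕ → J → StrongDual ℝ X := fun n => (A n)⁻¹ • fun j => W n j • us n j with hZ
  have hAinv : Tendsto (fun n => (A n)⁻¹) atTop (𝓝 0) := tendsto_inv_atTop_zero.comp hinf
  have hA0 : ∀ n, 0 ≤ (A n)⁻¹ := fun n => inv_nonneg.2 (norm_nonneg _)
  have hZ1 : ∀ᶠ n in atTop, ‖Z n‖ = 1 := by
    filter_upwards [hinf.eventually_gt_atTop 0] with n hn
    rw [hZ]
    simp only
    rw [norm_smul, norm_inv, Real.norm_of_nonneg (norm_nonneg _), inv_mul_cancel₀ hn.ne']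
  obtain ⟨φ, t₀, W₀, Z₀, hφ, ht₀, hs, hW₀, hZ₀⟩ := exists_subseq_tendsto hT (s := s) (Z := Z) hW
    (hZ1.mono fun n hn => hn.le).frequently
  have hφt := hφ.tendsto_atTop
  have hnorm : ‖Z₀‖ = 1 := tendsto_nhds_unique (hZ₀.norm)
    (tendsto_const_nhds.congr' ((hφt.eventually hZ1).mono fun n hn => hn.symm))
  refine hc (containsLine_of_sum_eq_zero smul_mem_iUnion_extSingularSub (z := Z₀) (fun j => ?_) ?_ ?_)
  · refine mem_iUnion₂.2 ⟨t₀ j, ht₀ j, ?_⟩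
    refine mem_extSingularSub_of_tendsto hb (hs j) (l := fun n => (A (φ n))⁻¹ * W (φ n) j)
      (fun n => mul_nonneg (hA0 _) (hW _ _).1) ?_ ((hu j).comp hφt) (fun n => hus (φ n) j)
      ((limsup_comp_le (g := fun n => f (s n j) (u n j)) hφ).trans (hval j)) ?_
    · simpa using (hAinv.comp hφt).mul (hW₀ j)
    · simpa only [hZ, Pi.smul_apply, mul_smul] using tendsto_pi_nhds.1 hZ₀ j
  · have h1 : Tendsto (fun n => ∑ j, Z (φ n) j) atTop (𝓝 (∑ j, Z₀ j)) :=
      tendsto_finsetSum _ fun j _ => tendsto_pi_nhds.1 hZ₀ j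
    have h2 : Tendsto (fun n => ∑ j, Z (φ n) j) atTop (𝓝 ((0 : ℝ) • V)) := by
      refine ((hAinv.comp hφt).smul (hV.comp hφt)).congr fun n => ?_
      simp only [hZ, Function.comp_apply, Pi.smul_apply, Finset.smul_sum]
    rw [tendsto_nhds_unique h1 h2, zero_smul]
  · rintro rfl
    simp at hnorm

/-- Weighted subgradients with a convergent sum converge termwise along a subsequence. -/
theorem exists_subseq_tendsto_smul [FiniteDimensional ℝ X] (hT : IsCompact (closure T))
    (hb : ContinuouslySubdifferentiable f x₀)
    (hc : ¬ ContainsLine (convexHull ℝ (⋃ t ∈ closure T, extSingularSub f t x₀)))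
    {J : Type*} [Fintype J] {s : ℕ → J → T} {u : ℕ → J → X} {us : ℕ → J → StrongDual ℝ X}
    {W : ℕ → J → ℝ} {κ : ℝ} {V : StrongDual ℝ X} (hW : ∀ n j, W n j ∈ Icc 0 κ)
    (hus : ∀ n j, us n j ∈ frechetSub (f (s n j)) (u n j))
    (hu : ∀ j, Tendsto (fun n => u n j) atTop (𝓝 x₀))
    (hval : ∀ j, limsup (fun n => f (s n j) (u n j)) atTop ≤ supFun f x₀)
    (hV : Tendsto (fun n => ∑ j, W n j • us n j) atTop (𝓝 V)) :
    ∃ (φ : ℕ → ℕ) (t₀ : J → M) (W₀ : J → ℝ) (Z₀ : J → StrongDual ℝ X), StrictMono φ ∧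
      (∀ j, t₀ j ∈ closure T) ∧ (∀ j, Tendsto (fun n => (s (φ n) j : M)) atTop (𝓝 (t₀ j))) ∧
      (∀ j, Tendsto (fun n => W (φ n) j) atTop (𝓝 (W₀ j))) ∧
      (∀ j, Tendsto (fun n => W (φ n) j • us (φ n) j) atTop (𝓝 (Z₀ j))) ∧ ∑ j, Z₀ j = V := by
  have hnot := not_tendsto_norm_atTop hT hb hc hW hus hu hval hV
  rw [tendsto_atTop] at hnot
  push Not at hnot
  obtain ⟨B, hB⟩ := hnot
  obtain ⟨φ, t₀, W₀, Z₀, hφ, ht₀, hs, hW₀, hZ₀⟩ := exists_subseq_tendsto hT (s := s) hW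
    (hB.mono fun n hn => hn.le)
  refine ⟨φ, t₀, W₀, Z₀, hφ, ht₀, hs, hW₀, fun j => tendsto_pi_nhds.1 hZ₀ j, ?_⟩
  exact tendsto_nhds_unique (tendsto_finsetSum _ fun j _ => tendsto_pi_nhds.1 hZ₀ j)
    (hV.comp hφ.tendsto_atTop)

/-- The approximate rule for suprema along a sequence, with a fixed number of terms. -/
theorem exists_seq_of_mem_frechetSub_supFun [FiniteDimensional ℝ X] {ι : Type*}
    {f : ι → X → EReal} {x₀ : X}
    (hbot : ∀ t x, f t x ≠ ⊥) (hlsc : ∀ t, LowerSemicontinuous (f t)) {m : ℝ}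
    (hm : supFun f x₀ = m) {x : ℕ → X} {xs : ℕ → StrongDual ℝ X}
    (hxs : ∀ n, xs n ∈ frechetSub (supFun f) (x n)) (hx : Tendsto x atTop (𝓝 x₀))
    (hfx : Tendsto (fun n => supFun f (x n)) atTop (𝓝 (supFun f x₀))) :
    ∃ (D : ℕ) (s : ℕ → Fin (D + 1) → ι) (u : ℕ → Fin (D + 1) → X)
      (us : ℕ → Fin (D + 1) → StrongDual ℝ X) (w c : ℕ → Fin (D + 1) → ℝ) (e : ℕ → ℝ),
      (∀ n j, us n j ∈ frechetSub (f (s n j)) (u n j)) ∧ (∀ n j, f (s n j) (u n j) = c n j) ∧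
      (∀ j, Tendsto (fun n => u n j) atTop (𝓝 x₀)) ∧
      (∀ n j, 0 ≤ w n j) ∧ (∀ n, ∑ j, w n j = 1) ∧
      (∀ n j, c n j ≤ m + e n) ∧ (∀ n, m - e n ≤ ∑ j, w n j * c n j) ∧ Tendsto e atTop (𝓝 0) ∧
      Tendsto (fun n => ∑ j, w n j • us n j - xs n) atTop (𝓝 0) := by
  have hfin : ∀ n, ∃ r : ℝ, supFun f (x n) = r := fun n =>
    let ⟨r, hr, _⟩ := mem_frechetSub_iff.1 (hxs n); ⟨r, hr⟩
  choose r hr using hfin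
  have hrm : Tendsto r atTop (𝓝 m) := by
    rw [hm] at hfx
    simp only [hr] at hfx
    exact EReal.tendsto_coe.1 hfx
  have hη : ∀ n : ℕ, 0 < 1 / ((n : ℝ) + 1) := fun n => by positivity
  have hηt : Tendsto (fun n : ℕ => 1 / ((n : ℝ) + 1)) atTop (𝓝 0) :=
    tendsto_one_div_add_atTop_nhds_zero_nat
  choose p hp hp1 hp2 using fun n =>
    exists_mem_convexHull_of_mem_frechetSub_supFun hbot hlsc (hxs n) (hr n) (hη n)
  choose z w hz hw0 hw1 hwz using fun n => exists_fin_of_mem_convexHull (hp n)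
  choose s u hus hfc hdist hle using hz
  refine ⟨_, s, u, fun n j => (z n j).1, w, fun n j => (z n j).2,
    fun n => 1 / ((n : ℝ) + 1) + |r n - m|, hus, hfc, fun j => ?_, hw0, hw1, fun n j => ?_,
    fun n => ?_, ?_, ?_⟩
  · have h1 : Tendsto (fun n : ℕ => 1 / ((n : ℝ) + 1) + dist (x n) x₀) atTop (𝓝 0) := by
      simpa using hηt.add (tendsto_iff_dist_tendsto_zero.1 hx)
    refine tendsto_iff_dist_tendsto_zero.2 (squeeze_zero (fun _ => dist_nonneg) (fun n => ?_) h1)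
    linarith [dist_triangle (u n j) (x n) x₀, hdist n j]
  · linarith [hle n j, le_abs_self (r n - m)]
  · have h1 : ∑ j, w n j * (z n j).2 = (p n).2 := by
      rw [← hwz n]; simp [Prod.snd_sum]
    rw [h1]
    linarith [hp2 n, neg_abs_le (r n - m)]
  · have h1 : Tendsto (fun n => |r n - m|) atTop (𝓝 0) := by
      simpa using (hrm.sub_const m).abs
    simpa using hηt.add h1
  · refine squeeze_zero_norm (fun n => ?_) hηt
    have h1 : ∑ j, w n j • (z n j).1 = (p n).1 := by
      rw [← hwz n]; simp [Prod.fst_sum]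
    rw [h1]
    exact hp1 n

theorem limsup_le_of_le_add {g : ℕ → EReal} {c e : ℕ → ℝ} {m : ℝ} (hg : ∀ n, g n = c n)
    (hc : ∀ n, c n ≤ m + e n) (he : Tendsto e atTop (𝓝 0)) : limsup g atTop ≤ m := by
  have h1 : Tendsto (fun n => ((m + e n : ℝ) : EReal)) atTop (𝓝 (m : EReal)) :=
    EReal.tendsto_coe.2 (by simpa using he.const_add m)
  rw [← h1.limsup_eq]
  refine limsup_le_limsup (Eventually.of_forall fun n => ?_)
  simp only [hg]
  exact EReal.coe_le_coe_iff.2 (hc n)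

/-- In a weighted mean that tends to an asymptotic upper bound of its terms, every term whose weight
does not vanish tends to the same limit. -/
theorem tendsto_of_sum_mul_tendsto {J : Type*} [Fintype J] {w c : ℕ → J → ℝ} {e : ℕ → ℝ} {m : ℝ}
    (hw0 : ∀ n j, 0 ≤ w n j) (hw1 : ∀ n, ∑ j, w n j = 1) (hc : ∀ n j, c n j ≤ m + e n)
    (hmean : ∀ n, m - e n ≤ ∑ j, w n j * c n j) (he : Tendsto e atTop (𝓝 0)) {j : J} {a : ℝ}
    (ha : 0 < a) (hwa : Tendsto (fun n => w n j) atTop (𝓝 a)) :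
    Tendsto (fun n => c n j) atTop (𝓝 m) := by
  have h1 : ∀ n, w n j * (m + e n - c n j) ≤ 2 * e n := fun n => by
    have h2 : w n j * (m + e n - c n j) ≤ ∑ i, w n i * (m + e n - c n i) :=
      Finset.single_le_sum (f := fun i => w n i * (m + e n - c n i))
        (fun i _ => mul_nonneg (hw0 n i) (by linarith [hc n i])) (Finset.mem_univ j)
    have h3 : ∑ i, w n i * (m + e n - c n i) = (m + e n) - ∑ i, w n i * c n i := by
      simp only [mul_sub, Finset.sum_sub_distrib, ← Finset.sum_mul, hw1, one_mul]
    linarith [hmean n]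
  have h2 : Tendsto (fun n => w n j * (m + e n - c n j)) atTop (𝓝 0) :=
    squeeze_zero (fun n => mul_nonneg (hw0 n j) (by linarith [hc n j])) h1
      (by simpa using he.const_mul 2)
  have h3 : Tendsto (fun n => m + e n - c n j) atTop (𝓝 (a⁻¹ * 0)) := by
    refine ((hwa.inv₀ ha.ne').mul h2).congr' ?_
    filter_upwards [hwa.eventually (lt_mem_nhds ha)] with n hn
    rw [← mul_assoc, inv_mul_cancel₀ hn.ne', one_mul]
  have h4 := (he.const_add m).sub h3
  simpa using h4

end SupSubdiff

/-! ### The subdifferentials of the supremum -/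

theorem mainTheorem3 {X : Type*} [NormedAddCommGroup X] [NormedSpace ℝ X] [FiniteDimensional ℝ X]
    {M : Type*} [MetricSpace M] (T : Set M) (hT : IsCompact (closure T))
    (f : T → X → EReal) (hbot : ∀ t x, f t x ≠ ⊥) (hlsc : ∀ t, LowerSemicontinuous (f t))
    (xbar : X)
    (ha : ∀ tbar : T, limsup (fun p : T × X => f p.1 p.2) (𝓝 (tbar, xbar)) ≤ f tbar xbar)
    (hb : SupSubdiff.ContinuouslySubdifferentiable f xbar)
    (hc : ¬ SupSubdiff.ContainsLine
      (convexHull ℝ (⋃ t ∈ closure T, SupSubdiff.extSingularSub f t xbar))) :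
    SupSubdiff.limitingSub (SupSubdiff.supFun f) xbar ⊆
        convexHull ℝ (⋃ t ∈ SupSubdiff.extActive f xbar, SupSubdiff.extLimitingSub f t xbar) +
          convexHull ℝ (⋃ t ∈ closure T, SupSubdiff.extSingularSub f t xbar) ∧
      SupSubdiff.singularSub (SupSubdiff.supFun f) xbar ⊆
        convexHull ℝ (⋃ t ∈ closure T, SupSubdiff.extSingularSub f t xbar) := by
  classical
  constructor
  · rintro V ⟨hbotx, htopx, x, xs, hxs, hx, hfx, hxsV⟩
    obtain ⟨m, hm⟩ : ∃ m : ℝ, SupSubdiff.supFun f xbar = m :=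
      ⟨_, (EReal.coe_toReal htopx hbotx).symm⟩
    obtain ⟨D, s, u, us, w, c, e, hus, hfc, hu, hw0, hw1, hce, hmean, he, hlim⟩ :=
      SupSubdiff.exists_seq_of_mem_frechetSub_supFun hbot hlsc hm hxs hx hfx
    have hval : ∀ j, limsup (fun n => f (s n j) (u n j)) atTop ≤ SupSubdiff.supFun f xbar :=
      fun j => hm ▸ SupSubdiff.limsup_le_of_le_add (fun n => hfc n j) (fun n => hce n j) he
    have hW : ∀ n j, w n j ∈ Icc 0 1 := fun n j => ⟨hw0 n j, hw1 n ▸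
      Finset.single_le_sum (f := w n) (fun i _ => hw0 n i) (Finset.mem_univ j)⟩
    have hV : Tendsto (fun n => ∑ j, w n j • us n j) atTop (𝓝 V) := by
      simpa using hlim.add hxsV
    obtain ⟨φ, t₀, W₀, Z₀, hφ, ht₀, hs, hW₀, hZ₀, hsum⟩ :=
      SupSubdiff.exists_subseq_tendsto_smul hT hb hc hW hus hu hval hV
    have hφt := hφ.tendsto_atTop
    have hW₀0 : ∀ j, 0 ≤ W₀ j := fun j => ge_of_tendsto' (hW₀ j) fun n => hw0 _ j
    have hW₀1 : ∑ j, W₀ j = 1 := tendsto_nhds_unique (tendsto_finsetSum _ fun j _ => hW₀ j)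
      (by simp only [hw1]; exact tendsto_const_nhds)
    have hvalφ : ∀ j, limsup (fun n => f (s (φ n) j) (u (φ n) j)) atTop ≤
        SupSubdiff.supFun f xbar := fun j =>
      (SupSubdiff.limsup_comp_le (g := fun n => f (s n j) (u n j)) hφ).trans (hval j)
    -- terms with a positive limit weight are active and give limiting subgradients
    have hpos : ∀ j, 0 < W₀ j → (W₀ j)⁻¹ • Z₀ j ∈
        ⋃ t ∈ SupSubdiff.extActive f xbar, SupSubdiff.extLimitingSub f t xbar := by
      intro j hj
      have hcm : Tendsto (fun n => c (φ n) j) atTop (𝓝 m) :=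
        SupSubdiff.tendsto_of_sum_mul_tendsto (w := fun n => w (φ n)) (c := fun n => c (φ n))
          (fun n => hw0 (φ n)) (fun n => hw1 (φ n)) (fun n => hce (φ n)) (fun n => hmean (φ n))
          (he.comp hφt) hj (hW₀ j)
      have hfm : Tendsto (fun n => f (s (φ n) j) (u (φ n) j)) atTop
          (𝓝 (SupSubdiff.supFun f xbar)) := by
        simp only [hfc, hm]
        exact EReal.tendsto_coe.2 hcm
      exact mem_iUnion₂.2 ⟨t₀ j,
        SupSubdiff.mem_extActive_of_tendsto ha (ht₀ j) (hs j) ((hu j).comp hφt) hfm,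
        SupSubdiff.inv_smul_mem_extLimitingSub_of_tendsto hb (hs j) (fun n => hw0 _ j) hj (hW₀ j)
          ((hu j).comp hφt) (fun n => hus (φ n) j) hfm (hZ₀ j)⟩
    -- the other terms, and zero, are singular subgradients
    have hsing : ∀ j, (if 0 < W₀ j then 0 else Z₀ j) ∈
        ⋃ t ∈ closure T, SupSubdiff.extSingularSub f t xbar := by
      intro j
      refine mem_iUnion₂.2 ⟨t₀ j, ht₀ j, ?_⟩
      split_ifs with hj
      · have h1 : Tendsto (fun n : ℕ => 1 / ((n : ℝ) + 1)) atTop (𝓝 0) :=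
          tendsto_one_div_add_atTop_nhds_zero_nat
        refine SupSubdiff.mem_extSingularSub_of_tendsto hb (hs j)
          (l := fun n => 1 / ((n : ℝ) + 1) * w (φ n) j)
          (fun n => mul_nonneg (by positivity) (hw0 _ j)) (by simpa using h1.mul (hW₀ j))
          ((hu j).comp hφt) (fun n => hus (φ n) j) (hvalφ j) ?_
        simpa only [mul_smul, zero_smul] using h1.smul (hZ₀ j)
      · refine SupSubdiff.mem_extSingularSub_of_tendsto hb (hs j) (fun n => hw0 (φ n) j) ?_
          ((hu j).comp hφt) (fun n => hus (φ n) j) (hvalφ j) (hZ₀ j)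
        have h1 : W₀ j = 0 := le_antisymm (not_lt.1 hj) (hW₀0 j)
        exact h1 ▸ hW₀ j
    refine ⟨∑ j with 0 < W₀ j, W₀ j • (W₀ j)⁻¹ • Z₀ j, ?_, ∑ j, (if 0 < W₀ j then 0 else Z₀ j),
      SupSubdiff.sum_mem_convexHull_of_cone SupSubdiff.smul_mem_iUnion_extSingularSub
        Finset.univ_nonempty fun j _ => hsing j, ?_⟩
    · refine (convex_convexHull ℝ _).sum_mem (fun j _ => hW₀0 j) ?_ fun j hj =>
        subset_convexHull ℝ _ (hpos j (Finset.mem_filter.1 hj).2)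
      rw [← hW₀1]
      refine Finset.sum_filter_of_ne fun j _ hj => lt_of_le_of_ne (hW₀0 j) hj.symm
    · simp only
      rw [Finset.sum_filter, ← Finset.sum_add_distrib, ← hsum]
      refine Finset.sum_congr rfl fun j _ => ?_
      split_ifs with hj
      · rw [smul_smul, mul_inv_cancel₀ hj.ne', one_smul, add_zero]
      · rw [zero_add]
  · rintro V ⟨hbotx, htopx, x, xs, η, hxs, hx, hfx, hη, hxsV⟩
    obtain ⟨m, hm⟩ : ∃ m : ℝ, SupSubdiff.supFun f xbar = m :=
      ⟨_, (EReal.coe_toReal htopx hbotx).symm⟩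
    obtain ⟨D, s, u, us, w, c, e, hus, hfc, hu, hw0, hw1, hce, hmean, he, hlim⟩ :=
      SupSubdiff.exists_seq_of_mem_frechetSub_supFun hbot hlsc hm hxs hx hfx
    have hval : ∀ j, limsup (fun n => f (s n j) (u n j)) atTop ≤ SupSubdiff.supFun f xbar :=
      fun j => hm ▸ SupSubdiff.limsup_le_of_le_add (fun n => hfc n j) (fun n => hce n j) he
    obtain ⟨hη0, hηpos⟩ := tendsto_nhdsWithin_iff.1 hη
    -- `|η n|` equals `η n` eventually, and is nonnegative for every `n`
    obtain ⟨κ, hκ⟩ := hη0.abs.bddAbove_range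
    have hw1' : ∀ n j, w n j ≤ 1 := fun n j => hw1 n ▸
      Finset.single_le_sum (f := w n) (fun i _ => hw0 n i) (Finset.mem_univ j)
    have hW : ∀ n j, |η n| * w n j ∈ Icc 0 κ := fun n j =>
      ⟨mul_nonneg (abs_nonneg _) (hw0 n j),
        (mul_le_of_le_one_right (abs_nonneg _) (hw1' n j)).trans (hκ ⟨n, rfl⟩)⟩
    have hV : Tendsto (fun n => ∑ j, (|η n| * w n j) • us n j) atTop (𝓝 V) := by
      have h1 := (hη0.smul hlim).add hxsV
      rw [smul_zero, zero_add] at h1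
      refine h1.congr' ?_
      filter_upwards [hηpos] with n hn
      rw [abs_of_pos hn, smul_sub, sub_add_cancel, Finset.smul_sum]
      simp only [mul_smul]
    obtain ⟨φ, t₀, W₀, Z₀, hφ, ht₀, hs, hW₀, hZ₀, hsum⟩ :=
      SupSubdiff.exists_subseq_tendsto_smul hT hb hc hW hus hu hval hV
    have hφt := hφ.tendsto_atTop
    rw [← hsum]
    refine SupSubdiff.sum_mem_convexHull_of_cone SupSubdiff.smul_mem_iUnion_extSingularSub
      Finset.univ_nonempty fun j _ => mem_iUnion₂.2 ⟨t₀ j, ht₀ j, ?_⟩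
    refine SupSubdiff.mem_extSingularSub_of_tendsto hb (hs j) (fun n => (hW (φ n) j).1) ?_
      ((hu j).comp hφt) (fun n => hus (φ n) j)
      ((SupSubdiff.limsup_comp_le (g := fun n => f (s n j) (u n j)) hφ).trans (hval j)) (hZ₀ j)
    have h1 : Tendsto (fun n => |η (φ n)|) atTop (𝓝 0) := by
      simpa using (hη0.comp hφt).abs
    exact squeeze_zero (fun n => (hW (φ n) j).1)
      (fun n => mul_le_of_le_one_right (abs_nonneg _) (hw1' _ j)) h1
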